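/- Let $\mathbb K$ be an algebraically closed field of characteristic zero. Let $\mathcal C$ be a fusion category over $\mathbb K$ with a spherical pivotal structure $p_X\colon X\to X^{\vee\vee}$, where $\mathrm{cre}_X\colon \mathbf 1\to X\otimes X^\vee$ and $\mathrm{ann}_X\colon X^\vee\otimes X\to\mathbf 1$ are the duality morphisms, and let $F=\mathrm{Gr}(\mathcal C)\otimes_{\mathbb Z}\mathbb K$ be its fusion algebra. Let $\mathcal B$ be a semisimple $\mathbb K$-linear category with finite-dimensional morphism spaces and finitely many simple objects up to isomorphism, let $\mathrm{Irr}(\mathcal B)$ be a set of representatives of its simple objects, and let $\mathrm{End}(\mathcal B)$ be the monoidal category of $\mathbb K$-linear endofunctors of $\mathcal B$, with $G\otimes H=G\circ H$. Let $\mathcal M\colon\mathcal C\to\mathrm{End}(\mathcal B)$ be a $\mathbb K$-linear monoidal functor (a finite module category) which is pivotal, i.e. $\alpha^{\vee\vee}\circ\mathcal M(p_X)=\mathcal M(p_Y)\circ\alpha$ for all $X,Y\in\mathcal C$ and all $\alpha\colon\mathcal M(X)\to\mathcal M(Y)$ in $\mathrm{End}(\mathcal B)$, where $\mathcal M(X^\vee)$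 is used as the dual of $\mathcal M(X)$. Then $\mathcal M(p)$ extends to a pivotal structure $p_A\colon A\to A^{\vee\vee}$ on the full subcategory $\mathcal D\subset\mathrm{End}(\mathcal B)$ of direct summands of objects $\mathcal M(X)$. The NIM-rep $\mathsf N=\mathrm{Gr}(\mathcal B)\otimes_{\mathbb Z}\mathbb K$ is the $F$-module with $[X]\cdot[b]=[\mathcal M(X)(b)]$. The encircling module $\mathsf E$ is the vector space $\mathrm{Nat}(\mathrm{id}_{\mathcal B})$ with the $F$-action $$[X]\cdot\alpha=\mathcal M(\mathrm{ann}_{X^\vee})\circ\bigl(\mathcal M(p_X)\otimes\alpha\otimes\mathrm{id}_{\mathcal M(X)^\vee}\bigr)\circ\mathcal M(\mathrm{cre}_X).$$ For $i\in\mathrm{Irr}(\mathcal B)$ let $\phi^i\in\mathrm{Nat}(\mathrm{id}_{\mathcal B})$ have component $\mathrm{id}_i$ at $i$ and $0$ at every other simple object. For $i,j\in\mathrm{Irr}(\mathcal B)$ let $e_{ij}\in\mathrm{End}(\mathcal B)$ be the simple object with $e_{ij}(j)\cong i$ and $e_{ij}(k)=0$ for $k\neq j$. Let $q_A\colon A\to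 A^{\vee\vee}$ be the standard pivotal structure on $\mathrm{End}(\mathcal B)$, i.e. the one for which the categorical trace $\mathrm{ann}_{A^\vee}\circ(q_Af\otimes\mathrm{id}_{A^\vee})\circ\mathrm{cre}_A$ of $f\colon A\to A$ has component $\sum_{j}\mathrm{tr}\bigl(f_j\circ-\mid\mathrm{Hom}(i,A(j))\bigr)\,\mathrm{id}_i$ at each $i\in\mathrm{Irr}(\mathcal B)$, where $f_j\colon A(j)\to A(j)$ is the component of $f$ at $j$ (so every $e_{ij}$ has dimension $1$). **Theorem.** The $\phi^i$ form a basis of $\mathsf E$. There are scalars $\lambda_i\in\mathbb K^*$, $i\in\mathrm{Irr}(\mathcal B)$, such that $$p_{e_{ij}}^{-1}\circ q_{e_{ij}}=\frac{\lambda_i}{\lambda_j}\,\mathrm{id}_{e_{ij}}\qquad\text{whenever } e_{ij}\in\mathcal D,$$ and for every such family $\{\lambda_i\}$ the linear map $\mathsf E\to\mathsf N$, $\phi^i\mapsto\lambda_i\,[i]$, is an isomorphism of $F$-modules. In particular $\mathsf E\cong\mathsf N$ as $F$-modules. -/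

import Mathlib

open CategoryTheory CategoryTheory.Limits MonoidalCategory
open scoped TensorProduct ZeroObject

namespace FusionModules

universe w v₁ v₂ u₁ u₂

section Grothendieck

variable (B : Type u₁) [Category.{v₁} B] [Preadditive B] [HasBinaryBiproducts B]

/-- The relations `[X ⊕ Y] = [X] + [Y]`. In a semisimple category every short exact sequence
splits, so these are all the relations of the Grothendieck group. They contain `[Z] = [X]` for
`Z ≅ X`. -/
def grRelations : AddSubgroup (FreeAbelianGroup B) :=
  AddSubgroup.closure {x | ∃ X Y Z : B, Nonempty (Z ≅ X ⊞ Y) ∧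
    x = FreeAbelianGroup.of Z - FreeAbelianGroup.of X - FreeAbelianGroup.of Y}

/-- The Grothendieck group `Gr(B)` of a (semisimple) category. -/
def Gr : Type u₁ := FreeAbelianGroup B ⧸ grRelations B

noncomputable instance : AddCommGroup (Gr B) :=
  inferInstanceAs (AddCommGroup (FreeAbelianGroup B ⧸ grRelations B))

variable {B}

/-- The class `[X]` of an object in the Grothendieck group. -/
def Gr.mk (X : B) : Gr B := QuotientAddGroup.mk' (grRelations B) (FreeAbelianGroup.of X)

theorem Gr.mk_add {X Y Z : B} (e : Z ≅ X ⊞ Y) : Gr.mk Z = Gr.mk X + Gr.mk Y := by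
  have h : QuotientAddGroup.mk' (grRelations B)
      (FreeAbelianGroup.of Z - FreeAbelianGroup.of X - FreeAbelianGroup.of Y) = 0 :=
    (QuotientAddGroup.eq_zero_iff _).2
      (AddSubgroup.subset_closure ⟨X, Y, Z, ⟨e⟩, rfl⟩)
  rw [map_sub, map_sub, sub_sub, sub_eq_zero] at h
  exact h

/-- The universal property of the Grothendieck group. -/
noncomputable def Gr.lift {A : Type*} [AddCommGroup A] (f : B → A)
    (hf : ∀ X Y Z : B, (Z ≅ X ⊞ Y) → f Z = f X + f Y) : Gr B →+ A :=
  QuotientAddGroup.lift (grRelations B) (FreeAbelianGroup.lift f) (by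
    rw [grRelations, AddSubgroup.closure_le]
    rintro x ⟨X, Y, Z, ⟨e⟩, rfl⟩
    simp [hf X Y Z e])

@[simp]
theorem Gr.lift_mk {A : Type*} [AddCommGroup A] (f : B → A)
    (hf : ∀ X Y Z : B, (Z ≅ X ⊞ Y) → f Z = f X + f Y) (X : B) :
    Gr.lift f hf (Gr.mk X) = f X :=
  FreeAbelianGroup.lift_apply_of f X

theorem Gr.induction {p : Gr B → Prop} (x : Gr B) (mk : ∀ X, p (Gr.mk X)) (zero : p 0)
    (add : ∀ x y, p x → p y → p (x + y)) (neg : ∀ x, p x → p (-x)) : p x := by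
  obtain ⟨y, rfl⟩ := QuotientAddGroup.mk'_surjective (grRelations B) x
  induction y using FreeAbelianGroup.induction_on with
  | zero => rw [map_zero]; exact zero
  | of X => exact mk X
  | neg X h => rw [map_neg]; exact neg _ h
  | add x y hx hy => rw [map_add]; exact add _ _ hx hy

theorem Gr.hom_ext {A : Type*} [AddCommGroup A] {f g : Gr B →+ A}
    (h : ∀ X, f (Gr.mk X) = g (Gr.mk X)) : f = g :=
  AddMonoidHom.ext fun x => Gr.induction (p := fun x => f x = g x) x h
    (by rw [map_zero, map_zero])
    (fun x y hx hy => by rw [map_add, map_add, hx, hy])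
    (fun x hx => by rw [map_neg, map_neg, hx])

theorem Gr.mk_zero {X : B} (h : IsZero X) : Gr.mk X = 0 := by
  have e : X ≅ X ⊞ X := h.iso ((biprod_isZero_iff X X).2 ⟨h, h⟩)
  simpa using Gr.mk_add e

theorem Gr.mk_congr [HasZeroObject B] {X Y : B} (e : X ≅ Y) : Gr.mk X = Gr.mk Y := by
  have h : IsZero (0 : B) := isZero_zero B
  have h1 := Gr.mk_add (e ≪≫ isoBiprodZero h)
  rwa [Gr.mk_zero h, add_zero] at h1

/-- An additive functor preserves direct sums. -/
noncomputable def additiveMapBiprod {D : Type*} [Category* D] [Preadditive D]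
    [HasBinaryBiproducts D] (F : B ⥤ D) [F.Additive] {X Y Z : B} (e : Z ≅ X ⊞ Y) :
    F.obj Z ≅ F.obj X ⊞ F.obj Y :=
  haveI := preservesBinaryBiproducts_of_preservesBiproducts F
  F.mapIso e ≪≫ F.mapBiprod X Y

end Grothendieck

section GrothendieckRing

variable {C : Type u₁} [Category.{v₁} C] [Preadditive C] [HasBinaryBiproducts C]
  [MonoidalCategory C] [MonoidalPreadditive C]

/-- The product on the Grothendieck ring, `[X] * [Y] = [X ⊗ Y]`. -/
noncomputable def Gr.mulHom : Gr C →+ Gr C →+ Gr C :=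
  Gr.lift (fun X => Gr.lift (fun Y => Gr.mk (X ⊗ Y))
      (fun _ _ _ e => Gr.mk_add (additiveMapBiprod (tensorLeft X) e)))
    (fun _ _ _ e => Gr.hom_ext fun Y => by
      simpa using Gr.mk_add (additiveMapBiprod (tensorRight Y) e))

noncomputable instance : Mul (Gr C) := ⟨fun x y => Gr.mulHom x y⟩

noncomputable instance : One (Gr C) := ⟨Gr.mk (𝟙_ C)⟩

theorem Gr.mk_mul (X Y : C) : Gr.mk X * Gr.mk Y = Gr.mk (X ⊗ Y) := by
  change Gr.mulHom (Gr.mk X) (Gr.mk Y) = _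
  simp [Gr.mulHom]

/-- The Grothendieck ring of a monoidal category. -/
noncomputable instance [HasZeroObject C] : Ring (Gr C) :=
  { (inferInstance : AddCommGroup (Gr C)) with
    left_distrib := fun x y z => map_add (Gr.mulHom x) y z
    right_distrib := fun x y z => by
      change Gr.mulHom (x + y) z = Gr.mulHom x z + Gr.mulHom y z
      simp
    zero_mul := fun x => by
      change Gr.mulHom 0 x = 0
      simp
    mul_zero := fun x => map_zero (Gr.mulHom x)
    mul_assoc := fun x y z => by
      change Gr.mulHom (Gr.mulHom x y) z = Gr.mulHom x (Gr.mulHom y z)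
      induction x using Gr.induction with
      | zero => simp
      | add _ _ h h' => simp [h, h']
      | neg _ h => simp [h]
      | mk X =>
        induction y using Gr.induction with
        | zero => simp
        | add _ _ h h' => simp [h, h']
        | neg _ h => simp [h]
        | mk Y =>
          induction z using Gr.induction with
          | zero => simp
          | add _ _ h h' => simp [h, h']
          | neg _ h => simp [h]
          | mk Z =>
            simpa [Gr.mulHom] using Gr.mk_congr (α_ X Y Z)
    one_mul := fun x => by
      change Gr.mulHom (Gr.mk (𝟙_ C)) x = x
      induction x using Gr.induction with
      | zero => simp
      | add _ _ h h' => simp [h, h']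
      | neg _ h => simp [h]
      | mk X =>
        simpa [Gr.mulHom] using Gr.mk_congr (λ_ X)
    mul_one := fun x => by
      change Gr.mulHom x (Gr.mk (𝟙_ C)) = x
      induction x using Gr.induction with
      | zero => simp
      | add _ _ h h' => simp [h, h']
      | neg _ h => simp [h]
      | mk X =>
        simpa [Gr.mulHom] using Gr.mk_congr (ρ_ X) }

/-- The universal property of the Grothendieck ring. -/
noncomputable def Gr.liftRingHom [HasZeroObject C] {R : Type*} [Ring R] (f : C → R)
    (hf : ∀ X Y Z : C, (Z ≅ X ⊞ Y) → f Z = f X + f Y) (h1 : f (𝟙_ C) = 1)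
    (hmul : ∀ X Y, f (X ⊗ Y) = f X * f Y) : Gr C →+* R :=
  { Gr.lift f hf with
    map_one' := (Gr.lift_mk f hf _).trans h1
    map_mul' := fun x y => by
      change Gr.lift f hf (x * y) = Gr.lift f hf x * Gr.lift f hf y
      induction x using Gr.induction with
      | zero => simp
      | add _ _ h h' => simp [add_mul, h, h']
      | neg _ h => simp [h]
      | mk X =>
        induction y using Gr.induction with
        | zero => simp
        | add _ _ h h' => simp [mul_add, h, h']
        | neg _ h => simp [h]
        | mk Y => rw [Gr.mk_mul, Gr.lift_mk, Gr.lift_mk, Gr.lift_mk, hmul] }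

@[simp]
theorem Gr.liftRingHom_mk [HasZeroObject C] {R : Type*} [Ring R] (f : C → R)
    (hf : ∀ X Y Z : C, (Z ≅ X ⊞ Y) → f Z = f X + f Y) (h1 : f (𝟙_ C) = 1)
    (hmul : ∀ X Y, f (X ⊗ Y) = f X * f Y) (X : C) :
    Gr.liftRingHom f hf h1 hmul (Gr.mk X) = f X :=
  Gr.lift_mk f hf X

end GrothendieckRing
section EndCat

variable (K : Type w) [Field K] (B : Type u₁) [Category.{v₁} B] [Preadditive B] [Linear K B]

/-- `End(B)`: the category of `K`-linear endofunctors of `B` and natural transformations. -/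
abbrev LinEnd : Type (max u₁ v₁) :=
  ObjectProperty.FullSubcategory (fun F : B ⥤ B => F.Additive ∧ F.Linear K)

variable {K B}

/-- `End(B)` is monoidal under composition of functors: `(F ⊗ G)(b) = F(G(b))`. -/
instance : MonoidalCategory (LinEnd K B) where
  tensorObj F G := ⟨G.obj ⋙ F.obj,
    haveI := F.property.1; haveI := G.property.1; haveI := F.property.2; haveI := G.property.2
    ⟨inferInstance, inferInstance⟩⟩
  whiskerLeft F _ _ β := ObjectProperty.homMk (Functor.whiskerRight β.hom F.obj)
  whiskerRight α G := ObjectProperty.homMk (Functor.whiskerLeft G.obj α.hom)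
  tensorUnit := ⟨𝟭 B, ⟨inferInstance, inferInstance⟩⟩
  associator F G H := ObjectProperty.isoMk _ (Functor.associator H.obj G.obj F.obj).symm
  leftUnitor F := ObjectProperty.isoMk _ (Functor.rightUnitor F.obj)
  rightUnitor F := ObjectProperty.isoMk _ (Functor.leftUnitor F.obj)

instance : MonoidalPreadditive (LinEnd K B) where
  whiskerLeft_zero {F _ _} := by
    have := F.property.1
    ext b; exact F.obj.map_zero _ _
  zero_whiskerRight := by intros; ext b; rfl
  whiskerLeft_add {F _ _} f g := by
    have := F.property.1
    ext b; exact F.obj.map_add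
  add_whiskerRight := by intros; ext b; rfl

instance : MonoidalLinear K (LinEnd K B) where
  whiskerLeft_smul F _ _ r f := by
    have := F.property.2
    ext b; exact F.obj.map_smul _ _
  smul_whiskerRight := by intros; ext b; rfl

end EndCat
section Mates

variable {A : Type u₁} [Category.{v₁} A] [MonoidalCategory A]

/-- The dual `f^∨ : W' ⟶ V'` of a morphism `f : V ⟶ W`, where `V'` and `W'` are duals of `V` and
`W`. -/
def mate {V V' W W' : A} [ExactPairing V V'] [ExactPairing W W'] (f : V ⟶ W) : W' ⟶ V' :=
  @rightAdjointMate A _ _ V W ⟨V'⟩ ⟨W'⟩ f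

/-- The double dual `f^∨∨ : V'' ⟶ W''` of a morphism `f : V ⟶ W`, where `V'` is a dual of `V`,
`V''` is a dual of `V'`, and likewise for `W`. The double dual of an identity is the canonical
comparison between two double duals of the same object. -/
def doubleMate {V W : A} (V' V'' W' W'' : A) [ExactPairing V V'] [ExactPairing V' V'']
    [ExactPairing W W'] [ExactPairing W' W''] (f : V ⟶ W) : V'' ⟶ W'' :=
  mate (mate f : W' ⟶ V')

/-- For `p : V ⟶ V^∨∨` and `α : 𝟙 ⟶ 𝟙`, the endomorphism of the unit
`ann_{V^∨} ∘ (p ⊗ α ⊗ id_{V^∨}) ∘ cre_V`, i.e. `α` encircled by `V` with `p` on the loop. -/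
def encircle {V : A} (V' V'' : A) [ExactPairing V V'] [ExactPairing V' V''] (p : V ⟶ V'')
    (α : 𝟙_ A ⟶ 𝟙_ A) : 𝟙_ A ⟶ 𝟙_ A :=
  η_ V V' ≫ (p ⊗ₘ ((λ_ V').inv ≫ (α ⊗ₘ 𝟙 V') ≫ (λ_ V').hom)) ≫ ε_ V' V''

theorem coevaluation_mate {V V' W W' : A} [ExactPairing V V'] [ExactPairing W W'] (f : V ⟶ W) :
    η_ W W' ≫ W ◁ (mate f : W' ⟶ V') = η_ V V' ≫ f ▷ V' :=
  @coevaluation_comp_rightAdjointMate A _ _ V W ⟨V'⟩ ⟨W'⟩ f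

theorem mate_evaluation {V V' W W' : A} [ExactPairing V V'] [ExactPairing W W'] (f : V ⟶ W) :
    (mate f : W' ⟶ V') ▷ V ≫ ε_ V V' = W' ◁ f ≫ ε_ W W' :=
  @rightAdjointMate_comp_evaluation A _ _ V W ⟨V'⟩ ⟨W'⟩ f

theorem eq_mate {V V' W W' : A} [ExactPairing V V'] [ExactPairing W W'] (f : V ⟶ W)
    (g : W' ⟶ V') (h : η_ W W' ≫ W ◁ g = η_ V V' ≫ f ▷ V') : g = mate f := by
  rw [← coevaluation_mate (W' := W') f] at h
  have key : ∀ k : W' ⟶ V', k = (ρ_ W').inv ≫ W' ◁ (η_ W W' ≫ W ◁ k) ≫ (α_ _ _ _).inv ≫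
      ε_ W W' ▷ V' ≫ (λ_ V').hom := by
    intro k
    symm
    calc _ = 𝟙 _ ⊗≫ W' ◁ η_ W W' ⊗≫ ((W' ⊗ W) ◁ k ≫ ε_ W W' ▷ V') ⊗≫ 𝟙 _ := by monoidal
      _ = 𝟙 _ ⊗≫ (W' ◁ η_ W W' ⊗≫ ε_ W W' ▷ W') ⊗≫ k := by
        rw [whisker_exchange]; monoidal
      _ = _ := by rw [ExactPairing.coevaluation_evaluation'']; monoidal
  rw [key g, key (mate f), h]

theorem encircle_eq {V V' V'' : A} [ExactPairing V V'] [ExactPairing V' V''] (p : V ⟶ V'')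
    (α : 𝟙_ A ⟶ 𝟙_ A) : encircle V' V'' p α =
      η_ V V' ≫ p ▷ V' ≫ V'' ◁ ((λ_ V').inv ≫ α ▷ V' ≫ (λ_ V').hom) ≫ ε_ V' V'' := by
  unfold encircle
  simp [MonoidalCategory.tensorHom_def]

theorem encircle_cyclic {V V' V'' W W' W'' : A} [ExactPairing V V'] [ExactPairing V' V'']
    [ExactPairing W W'] [ExactPairing W' W''] (f : V ⟶ W) (g : W ⟶ V'') (α : 𝟙_ A ⟶ 𝟙_ A) :
    encircle V' V'' (f ≫ g) α = encircle W' W'' (g ≫ doubleMate V' V'' W' W'' f) α := by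
  have h1 := coevaluation_mate (V' := V') (W' := W') f
  have h2 := mate_evaluation (V := W') (V' := W'') (W := V') (W' := V'')
    (mate f : W' ⟶ V')
  have h3 : (mate f : W' ⟶ V') ≫ ((λ_ V').inv ≫ α ▷ V' ≫ (λ_ V').hom) =
      ((λ_ W').inv ≫ α ▷ W' ≫ (λ_ W').hom) ≫ (mate f : W' ⟶ V') := by
    rw [leftUnitor_inv_naturality_assoc, whisker_exchange_assoc]
    simp
  rw [encircle_eq, encircle_eq]
  unfold doubleMate
  simp only [comp_whiskerRight, Category.assoc]
  rw [← reassoc_of% h1, whisker_exchange_assoc, ← whiskerLeft_comp_assoc, h3, whiskerLeft_comp_assoc, ← h2,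
    whisker_exchange_assoc]

theorem encircle_tensor {V V' V'' W W' W'' : A} [ExactPairing V V'] [ExactPairing V' V'']
    [ExactPairing W W'] [ExactPairing W' W''] (p : V ⟶ V'') (q : W ⟶ W'') (α : 𝟙_ A ⟶ 𝟙_ A) :
    encircle (W' ⊗ V') (V'' ⊗ W'') (p ⊗ₘ q) α = encircle V' V'' p (encircle W' W'' q α) := by
  simp only [encircle_eq, ExactPairing.tensor_evaluation, ExactPairing.tensor_coevaluation,
    MonoidalCategory.tensorHom_def]
  calc _ = η_ V V' ⊗≫ (V ◁ η_ W W') ▷ V' ⊗≫ ((p ▷ (W ⊗ W')) ≫ V'' ◁ (q ▷ W')) ▷ V' ⊗≫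
        V'' ◁ W'' ◁ (α ▷ W') ▷ V' ⊗≫ V'' ◁ (ε_ W' W'' ▷ V') ⊗≫ ε_ V' V'' := by monoidal
    _ = η_ V V' ⊗≫ (V ◁ η_ W W' ≫ (p ▷ (W ⊗ W'))) ▷ V' ⊗≫ (V'' ◁ (q ▷ W')) ▷ V' ⊗≫
        V'' ◁ W'' ◁ (α ▷ W') ▷ V' ⊗≫ V'' ◁ (ε_ W' W'' ▷ V') ⊗≫ ε_ V' V'' := by monoidal
    _ = _ := by
      rw [whisker_exchange]; monoidal

theorem encircle_unit (α : 𝟙_ A ⟶ 𝟙_ A) : encircle (𝟙_ A) (𝟙_ A) (𝟙 (𝟙_ A)) α = α := by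
  have h1 : η_ (𝟙_ A) (𝟙_ A) = (ρ_ _).inv := rfl
  have h2 : ε_ (𝟙_ A) (𝟙_ A) = (ρ_ _).hom := rfl
  rw [encircle_eq, h1, h2]
  monoidal

end Mates

section MonoidalFunctor

open Functor.LaxMonoidal Functor.OplaxMonoidal

variable {C : Type u₁} [Category.{v₁} C] [MonoidalCategory C]
  {A : Type u₂} [Category.{v₂} A] [MonoidalCategory A] (M : C ⥤ A) [M.Monoidal]

/-- A monoidal functor takes a dual `V'` of `V` to a dual `M(V')` of `M(V)`. -/
instance mapExactPairing (V V' : C) [ExactPairing V V'] :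
    ExactPairing (M.obj V) (M.obj V') where
  coevaluation' := ε M ≫ M.map (η_ V V') ≫ δ M V V'
  evaluation' := μ M V' V ≫ M.map (ε_ V V') ≫ η M
  coevaluation_evaluation' := by
    have h := M.congr_map (ExactPairing.coevaluation_evaluation V V')
    rw [M.map_comp, M.map_comp, M.map_comp] at h
    rw [Functor.Monoidal.map_associator_inv']
    simp only [MonoidalCategory.whiskerLeft_comp, comp_whiskerRight, Category.assoc,
      Functor.Monoidal.whiskerLeft_δ_μ_assoc, Functor.Monoidal.whiskerRight_δ_μ_assoc]
    rw [μ_natural_right_assoc, δ_natural_left_assoc, reassoc_of% h]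
    simp
  evaluation_coevaluation' := by
    have h := M.congr_map (ExactPairing.evaluation_coevaluation V V')
    rw [M.map_comp, M.map_comp, M.map_comp] at h
    rw [Functor.Monoidal.map_associator']
    simp only [MonoidalCategory.whiskerLeft_comp, comp_whiskerRight, Category.assoc,
      Functor.Monoidal.whiskerLeft_δ_μ_assoc, Functor.Monoidal.whiskerRight_δ_μ_assoc]
    rw [μ_natural_left_assoc, δ_natural_right_assoc, reassoc_of% h]
    simp

theorem map_coevaluation (V V' : C) [ExactPairing V V'] :
    η_ (M.obj V) (M.obj V') = ε M ≫ M.map (η_ V V') ≫ δ M V V' := rfl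

theorem map_mate {V V' W W' : C} [ExactPairing V V'] [ExactPairing W W'] (f : V ⟶ W) :
    M.map (mate f : W' ⟶ V') = mate (M.map f) := by
  apply eq_mate
  have h := M.congr_map (coevaluation_mate (V' := V') (W' := W') f)
  simp only [map_coevaluation, Category.assoc]
  simp only [Functor.map_comp, Functor.Monoidal.map_whiskerLeft, Functor.Monoidal.map_whiskerRight] at h
  simp only [← Category.assoc, cancel_mono] at h
  simp only [Category.assoc] at h
  rw [h]

theorem map_doubleMate {V V' V'' W W' W'' : C} [ExactPairing V V'] [ExactPairing V' V'']
    [ExactPairing W W'] [ExactPairing W' W''] (f : V ⟶ W) :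
    M.map (doubleMate V' V'' W' W'' f) =
      doubleMate (M.obj V') (M.obj V'') (M.obj W') (M.obj W'') (M.map f) := by
  unfold doubleMate
  rw [map_mate, map_mate]

theorem map_tensor_coevaluation {V V' W W' : C} [ExactPairing V V'] [ExactPairing W W'] :
    η_ (M.obj (V ⊗ W)) (M.obj (W' ⊗ V')) =
      η_ (M.obj V ⊗ M.obj W) (M.obj W' ⊗ M.obj V') ≫ (μ M V W ⊗ₘ μ M W' V') := by
  have h : η_ (V ⊗ W) (W' ⊗ V') = η_ V V' ≫ V ◁ (λ_ V').inv ≫ V ◁ (η_ W W' ▷ V') ≫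
      V ◁ (α_ _ _ _).hom ≫ (α_ _ _ _).inv := by
    rw [ExactPairing.tensor_coevaluation]; monoidal
  have h' : η_ (M.obj V ⊗ M.obj W) (M.obj W' ⊗ M.obj V') =
      η_ (M.obj V) (M.obj V') ≫ M.obj V ◁ (λ_ _).inv ≫
      M.obj V ◁ (η_ (M.obj W) (M.obj W') ▷ M.obj V') ≫
      M.obj V ◁ (α_ _ _ _).hom ≫ (α_ _ _ _).inv := by
    rw [ExactPairing.tensor_coevaluation]; monoidal
  rw [map_coevaluation, h, h', map_coevaluation, map_coevaluation]
  simp only [Functor.map_comp, Functor.Monoidal.map_whiskerLeft, Functor.Monoidal.map_whiskerRight,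
    Functor.Monoidal.map_leftUnitor_inv, Functor.Monoidal.map_associator,
    Functor.Monoidal.map_associator_inv, MonoidalCategory.whiskerLeft_comp, comp_whiskerRight,
    Category.assoc, Functor.Monoidal.μ_δ, Functor.Monoidal.μ_δ_assoc,
    Functor.Monoidal.whiskerLeft_μ_δ_assoc, Category.comp_id, MonoidalCategory.tensorHom_def]
  rw [associator_inv_naturality_right_assoc, whisker_exchange]

theorem mate_δ {V V' W W' : C} [ExactPairing V V'] [ExactPairing W W'] :
    (mate (δ M V W) : M.obj W' ⊗ M.obj V' ⟶ M.obj (W' ⊗ V')) = μ M W' V' := by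
  symm
  apply eq_mate
  rw [map_tensor_coevaluation]
  simp [MonoidalCategory.tensorHom_def', ← comp_whiskerRight]

theorem mate_μ {V V' W W' : C} [ExactPairing V V'] [ExactPairing W W'] :
    (mate (μ M V W) : M.obj (W' ⊗ V') ⟶ M.obj W' ⊗ M.obj V') = δ M W' V' := by
  symm
  apply eq_mate
  rw [map_tensor_coevaluation]
  simp [MonoidalCategory.tensorHom_def, ← whiskerLeft_comp]

theorem doubleMate_δ {V V' V'' W W' W'' : C} [ExactPairing V V'] [ExactPairing V' V'']
    [ExactPairing W W'] [ExactPairing W' W''] :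
    doubleMate (M.obj (W' ⊗ V')) (M.obj (V'' ⊗ W'')) (M.obj W' ⊗ M.obj V')
      (M.obj V'' ⊗ M.obj W'') (δ M V W) = δ M V'' W'' := by
  unfold doubleMate
  rw [mate_δ, mate_μ]

theorem doubleMate_η :
    doubleMate (M.obj (𝟙_ C)) (M.obj (𝟙_ C)) (𝟙_ A) (𝟙_ A) (η M) = η M := by
  have h0 : η_ (𝟙_ C) (𝟙_ C) = (ρ_ _).inv := rfl
  have h0' : η_ (𝟙_ A) (𝟙_ A) = (ρ_ _).inv := rfl
  have h1 : (mate (η M) : 𝟙_ A ⟶ M.obj (𝟙_ C)) = ε M := by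
    symm
    apply eq_mate
    rw [map_coevaluation, h0, h0', ← unitors_inv_equal, ← unitors_inv_equal]
    simp
  have h2 : (mate (ε M) : M.obj (𝟙_ C) ⟶ 𝟙_ A) = η M := by
    symm
    apply eq_mate
    rw [map_coevaluation, h0, h0']
    simp
  rw [doubleMate, h1, h2]

end MonoidalFunctor


section EncircleLinear

variable {A : Type u₁} [Category.{v₁} A] [Preadditive A] [MonoidalCategory A]
  [MonoidalPreadditive A] {V V' V'' : A} [ExactPairing V V'] [ExactPairing V' V'']

theorem encircle_add_left (p q : V ⟶ V'') (α : 𝟙_ A ⟶ 𝟙_ A) :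
    encircle V' V'' (p + q) α = encircle V' V'' p α + encircle V' V'' q α := by
  simp [encircle_eq, Preadditive.add_comp, Preadditive.comp_add]

theorem encircle_add_right (p : V ⟶ V'') (α β : 𝟙_ A ⟶ 𝟙_ A) :
    encircle V' V'' p (α + β) = encircle V' V'' p α + encircle V' V'' p β := by
  simp [encircle_eq, Preadditive.add_comp, Preadditive.comp_add]

theorem encircle_smul_right {K : Type w} [Field K] [Linear K A] [MonoidalLinear K A]
    (p : V ⟶ V'') (c : K) (α : 𝟙_ A ⟶ 𝟙_ A) :
    encircle V' V'' p (c • α) = c • encircle V' V'' p α := by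
  simp [encircle_eq]

end EncircleLinear

section Pivotal

/-- The dual `X^∨`, with `cre_X : 𝟙 ⟶ X ⊗ X^∨` and `ann_X : X^∨ ⊗ X ⟶ 𝟙`. -/
abbrev dual {C : Type u₁} [Category.{v₁} C] [MonoidalCategory C] [RightRigidCategory C]
    (X : C) : C := Xᘁ

/-- The double dual `X^∨∨`. -/
abbrev ddual {C : Type u₁} [Category.{v₁} C] [MonoidalCategory C] [RightRigidCategory C]
    (X : C) : C := dual (dual X)

/-- A pivotal structure: a monoidal natural isomorphism `p_X : X ⟶ X^∨∨` from the identity to the double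
dual. -/
structure PivotalStructure (C : Type u₁) [Category.{v₁} C] [MonoidalCategory C]
    [RightRigidCategory C] where
  iso : ∀ X : C, X ≅ ddual X
  naturality : ∀ {X Y : C} (f : X ⟶ Y), f ≫ (iso Y).hom = (iso X).hom ≫ (fᘁ)ᘁ
  /-- compatibility with the canonical isomorphism `𝟙^∨∨ ≅ 𝟙` -/
  unit : (iso (𝟙_ C)).hom ≫
    doubleMate (dual (𝟙_ C)) (ddual (𝟙_ C)) (𝟙_ C) (𝟙_ C) (𝟙 (𝟙_ C)) = 𝟙 (𝟙_ C)
  /-- compatibility with the canonical isomorphism `(X ⊗ Y)^∨∨ ≅ X^∨∨ ⊗ Y^∨∨` -/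
  tensor : ∀ X Y : C, (iso (X ⊗ Y)).hom ≫
    doubleMate (dual (X ⊗ Y)) (ddual (X ⊗ Y)) (dual Y ⊗ dual X) (ddual X ⊗ ddual Y) (𝟙 (X ⊗ Y)) =
      (iso X).hom ⊗ₘ (iso Y).hom

variable {C : Type u₁} [Category.{v₁} C] [MonoidalCategory C] [RightRigidCategory C]

/-- A pivotal structure is spherical if the left and right categorical traces of every
endomorphism coincide. -/
def PivotalStructure.IsSpherical (P : PivotalStructure C) : Prop :=
  ∀ (X : C) (f : X ⟶ X),
    η_ X (dual X) ≫ (f ≫ (P.iso X).hom) ▷ (dual X) ≫ ε_ (dual X) (ddual X) =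
      η_ (dual X) (ddual X) ≫ (dual X) ◁ ((P.iso X).inv ≫ f) ≫ ε_ X (dual X)

end Pivotal

section ModuleCategory

variable {K : Type w} [Field K]
  {C : Type u₁} [Category.{v₁} C] [MonoidalCategory C] [RightRigidCategory C]
  {B : Type u₂} [Category.{v₂} B] [Preadditive B] [Linear K B]

/-- The operator `α ↦ X · α` on `Nat(id_B)`: encircling with `M(X)` through `M(p_X)`. -/
def encircleBy (P : PivotalStructure C) (M : C ⥤ LinEnd K B) [M.Monoidal] (X : C) :
    Module.End K (𝟙_ (LinEnd K B) ⟶ 𝟙_ (LinEnd K B)) where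
  toFun α := encircle (M.obj (dual X)) (M.obj (ddual X)) (M.map (P.iso X).hom) α
  map_add' := encircle_add_right _
  map_smul' c α := encircle_smul_right _ c α

theorem encircleBy_add [Preadditive C] [HasBinaryBiproducts C] (P : PivotalStructure C)
    (M : C ⥤ LinEnd K B) [M.Monoidal] [M.Additive] {X Y Z : C} (e : Z ≅ X ⊞ Y) :
    encircleBy P M Z = encircleBy P M X + encircleBy P M Y := by
  have key : ∀ (W : C) (i : W ⟶ Z) (r : Z ⟶ W), i ≫ r = 𝟙 W → ∀ α,
      encircle (M.obj (dual Z)) (M.obj (ddual Z)) (M.map (r ≫ i ≫ (P.iso Z).hom)) α =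
        encircleBy P M W α := by
    intro W i r h α
    have h1 : (i ≫ (P.iso Z).hom) ≫ doubleMate (dual Z) (ddual Z) (dual W) (ddual W) r = (P.iso W).hom := by
      have := P.naturality r
      change r ≫ _ = _ ≫ doubleMate (dual Z) (ddual Z) (dual W) (ddual W) r at this
      rw [Category.assoc, ← this, reassoc_of% h]
    rw [M.map_comp, encircle_cyclic (W' := M.obj (dual W)) (W'' := M.obj (ddual W)), ← map_doubleMate,
      ← M.map_comp, h1]
    rfl
  have h : (P.iso Z).hom = (e.hom ≫ biprod.fst) ≫ (biprod.inl ≫ e.inv) ≫ (P.iso Z).hom +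
      (e.hom ≫ biprod.snd) ≫ (biprod.inr ≫ e.inv) ≫ (P.iso Z).hom := by
    have h : (P.iso Z).hom = e.hom ≫ (biprod.fst ≫ biprod.inl + biprod.snd ≫ biprod.inr) ≫
        e.inv ≫ (P.iso Z).hom := by rw [biprod.total]; simp
    conv_lhs => rw [h]
    simp only [Preadditive.add_comp, Preadditive.comp_add, Category.assoc]
  ext1 α
  rw [LinearMap.add_apply, ← key X (biprod.inl ≫ e.inv) (e.hom ≫ biprod.fst) (by simp),
    ← key Y (biprod.inr ≫ e.inv) (e.hom ≫ biprod.snd) (by simp), ← encircle_add_left,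
    ← M.map_add, ← h]
  rfl

theorem encircleBy_unit (P : PivotalStructure C) (M : C ⥤ LinEnd K B) [M.Monoidal] :
    encircleBy P M (𝟙_ C) = 1 := by
  ext1 α
  change encircle _ _ (M.map (P.iso (𝟙_ C)).hom) α = α
  rw [← Category.id_comp (M.map (P.iso (𝟙_ C)).hom), ← M.map_id,
    encircle_cyclic (W' := M.obj (𝟙_ C)) (W'' := M.obj (𝟙_ C)), ← map_doubleMate,
    ← M.map_comp, P.unit, M.map_id, ← Functor.Monoidal.η_ε M,
    encircle_cyclic (W' := 𝟙_ _) (W'' := 𝟙_ _), doubleMate_η, Functor.Monoidal.ε_η,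
    encircle_unit]

theorem encircleBy_tensor (P : PivotalStructure C) (M : C ⥤ LinEnd K B) [M.Monoidal] (X Y : C) :
    encircleBy P M (X ⊗ Y) = encircleBy P M X * encircleBy P M Y := by
  ext1 α
  change encircle _ _ (M.map (P.iso (X ⊗ Y)).hom) α =
    encircle _ _ (M.map (P.iso X).hom) (encircle _ _ (M.map (P.iso Y).hom) α)
  rw [← Category.id_comp (M.map (P.iso (X ⊗ Y)).hom), ← M.map_id,
    encircle_cyclic (W' := M.obj (dual Y ⊗ dual X)) (W'' := M.obj (ddual X ⊗ ddual Y)), ← map_doubleMate,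
    ← M.map_comp, P.tensor, Functor.Monoidal.map_tensor,
    encircle_cyclic (W' := M.obj (dual Y) ⊗ M.obj (dual X)) (W'' := M.obj (ddual X) ⊗ M.obj (ddual Y)),
    doubleMate_δ, Category.assoc, Functor.Monoidal.μ_δ, Category.comp_id, encircle_tensor]

/-- The operator `[b] ↦ [M(X)(b)]` on `Gr(B)`. -/
noncomputable def nimOperator [HasBinaryBiproducts B] (M : C ⥤ LinEnd K B) (X : C) :
    Module.End ℤ (Gr B) :=
  (Gr.lift (fun b : B => Gr.mk ((M.obj X).obj.obj b)) (fun _ _ _ e =>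
    haveI := (M.obj X).property.1
    Gr.mk_add (additiveMapBiprod (M.obj X).obj e))).toIntLinearMap

theorem nimOperator_mk [HasBinaryBiproducts B] (M : C ⥤ LinEnd K B) (X : C) (b : B) :
    nimOperator M X (Gr.mk b) = Gr.mk ((M.obj X).obj.obj b) := by
  simp [nimOperator]

theorem int_end_ext [HasBinaryBiproducts B] {f g : Module.End ℤ (Gr B)}
    (h : ∀ b, f (Gr.mk b) = g (Gr.mk b)) : f = g :=
  LinearMap.toAddMonoidHom_injective (Gr.hom_ext h)

/-- The functor `X ↦ M(X)(b)`. -/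
def actOn (M : C ⥤ LinEnd K B) (b : B) : C ⥤ B :=
  M ⋙ ObjectProperty.ι _ ⋙ (evaluation B B).obj b

instance [Preadditive C] (M : C ⥤ LinEnd K B) [M.Additive] (b : B) : (actOn M b).Additive where
  map_add {X Y f g} := by
    change (M.map (f + g)).hom.app b = (M.map f).hom.app b + (M.map g).hom.app b
    rw [M.map_add]
    rfl

/-- The underlying space `Nat(id_B)` of the encircling module. -/
def EncirclingModule (_P : PivotalStructure C) (_M : C ⥤ LinEnd K B) : Type (max u₂ v₂) :=
  𝟙_ (LinEnd K B) ⟶ 𝟙_ (LinEnd K B)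

noncomputable instance (P : PivotalStructure C) (M : C ⥤ LinEnd K B) :
    AddCommGroup (EncirclingModule P M) :=
  inferInstanceAs (AddCommGroup (𝟙_ (LinEnd K B) ⟶ 𝟙_ (LinEnd K B)))

noncomputable instance (P : PivotalStructure C) (M : C ⥤ LinEnd K B) :
    Module K (EncirclingModule P M) :=
  inferInstanceAs (Module K (𝟙_ (LinEnd K B) ⟶ 𝟙_ (LinEnd K B)))

/-- The component `b ⟶ b` of a natural endomorphism of `id_B`. -/
def natApp (α : 𝟙_ (LinEnd K B) ⟶ 𝟙_ (LinEnd K B)) (b : B) : b ⟶ b :=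
  α.hom.app b

/-- The underlying space `K ⊗ Gr(B)` of the complexified NIM-rep. -/
def NIMRep [HasBinaryBiproducts B] (_M : C ⥤ LinEnd K B) : Type (max w u₂) := K ⊗[ℤ] Gr B

noncomputable instance [HasBinaryBiproducts B] (M : C ⥤ LinEnd K B) : AddCommGroup (NIMRep M) :=
  inferInstanceAs (AddCommGroup (K ⊗[ℤ] Gr B))

noncomputable instance [HasBinaryBiproducts B] (M : C ⥤ LinEnd K B) : Module K (NIMRep M) :=
  inferInstanceAs (Module K (K ⊗[ℤ] Gr B))

/-- The class `[b]` of an object in the complexified NIM-rep. -/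
noncomputable def NIMRep.mk [HasBinaryBiproducts B] (M : C ⥤ LinEnd K B) (b : B) : NIMRep M :=
  (1 : K) ⊗ₜ[ℤ] Gr.mk b

variable [Preadditive C] [HasZeroObject C] [HasBinaryBiproducts C] [MonoidalPreadditive C]

/-- The fusion algebra `F = K ⊗ Gr(C)`. -/
abbrev FusionAlgebra (K : Type w) [Field K] (C : Type u₁) [Category.{v₁} C] [Preadditive C]
    [HasZeroObject C] [HasBinaryBiproducts C] [MonoidalCategory C] [MonoidalPreadditive C] :
    Type (max w u₁) :=
  K ⊗[ℤ] Gr C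

/-- The extension of scalars of a representation of `Gr(C)` to the fusion algebra. -/
noncomputable def extendScalars {V : Type*} [AddCommGroup V] [Module K V]
    (f : Gr C →+* Module.End K V) : FusionAlgebra K C →ₐ[K] Module.End K V :=
  Algebra.TensorProduct.lift (Algebra.ofId K _) f.toIntAlgHom
    (by intro c x; exact Algebra.commutes c (f x))

theorem extendScalars_tmul {V : Type*} [AddCommGroup V] [Module K V]
    (f : Gr C →+* Module.End K V) (c : K) (x : Gr C) (v : V) :
    extendScalars f (c ⊗ₜ[ℤ] x) v = c • f x v := by
  have h := Algebra.TensorProduct.lift_tmul (R := ℤ) (Algebra.ofId K (Module.End K V))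
    f.toIntAlgHom (by intro c x; exact Algebra.commutes c (f x)) c x
  unfold extendScalars
  rw [h]
  rfl

/-- The action of the Grothendieck ring on `Nat(id_B)`, `[X] ↦ (α ↦ X · α)`. -/
noncomputable def encirclingHom (P : PivotalStructure C) (M : C ⥤ LinEnd K B) [M.Monoidal]
    [M.Additive] : Gr C →+* Module.End K (𝟙_ (LinEnd K B) ⟶ 𝟙_ (LinEnd K B)) :=
  Gr.liftRingHom (encircleBy P M) (fun _ _ _ e => encircleBy_add P M e) (encircleBy_unit P M)
    (encircleBy_tensor P M)

/-- The encircling module `E` over the fusion algebra. -/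
noncomputable instance (P : PivotalStructure C) (M : C ⥤ LinEnd K B) [M.Monoidal] [M.Additive] :
    Module (FusionAlgebra K C) (EncirclingModule P M) :=
  Module.compHom (𝟙_ (LinEnd K B) ⟶ 𝟙_ (LinEnd K B))
    (extendScalars (encirclingHom P M)).toRingHom

theorem encircling_smul (P : PivotalStructure C) (M : C ⥤ LinEnd K B) [M.Monoidal] [M.Additive]
    (c : K) (X : C) (α : EncirclingModule P M) :
    ((c ⊗ₜ[ℤ] Gr.mk X : FusionAlgebra K C) • α : EncirclingModule P M) =
      c • encircle (M.obj (dual X)) (M.obj (ddual X)) (M.map (P.iso X).hom) α := by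
  have h : encirclingHom P M (Gr.mk X) = encircleBy P M X := Gr.liftRingHom_mk _ _ _ _ X
  refine (extendScalars_tmul (encirclingHom P M) c (Gr.mk X) α).trans ?_
  rw [h]
  rfl

variable [HasZeroObject B] [HasBinaryBiproducts B]

/-- The NIM-rep `Gr(C) → End(Gr(B))`, `[X] ↦ ([b] ↦ [M(X)(b)])`. -/
noncomputable def nimHom (M : C ⥤ LinEnd K B) [M.Monoidal] [M.Additive] :
    Gr C →+* Module.End ℤ (Gr B) :=
  Gr.liftRingHom (nimOperator M)
    (fun X Y Z e => int_end_ext fun b => by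
      rw [LinearMap.add_apply, nimOperator_mk, nimOperator_mk, nimOperator_mk]
      exact Gr.mk_add (additiveMapBiprod (actOn M b) e))
    (int_end_ext fun b => by
      rw [nimOperator_mk]
      exact Gr.mk_congr (((ObjectProperty.ι _).mapIso (Functor.Monoidal.εIso M).symm).app b))
    (fun X Y => int_end_ext fun b => by
      rw [Module.End.mul_apply, nimOperator_mk, nimOperator_mk, nimOperator_mk]
      exact Gr.mk_congr (((ObjectProperty.ι _).mapIso (Functor.Monoidal.μIso M X Y).symm).app b))

/-- The complexified NIM-rep `N` as a module over the fusion algebra. -/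
noncomputable instance (M : C ⥤ LinEnd K B) [M.Monoidal] [M.Additive] :
    Module (FusionAlgebra K C) (NIMRep M) :=
  Module.compHom (K ⊗[ℤ] Gr B)
    (extendScalars ((Module.End.baseChangeHom ℤ K (Gr B)).toRingHom.comp (nimHom M))).toRingHom

theorem nimRep_smul (M : C ⥤ LinEnd K B) [M.Monoidal] [M.Additive] (c : K) (X : C) (b : B) :
    (c ⊗ₜ[ℤ] Gr.mk X : FusionAlgebra K C) • NIMRep.mk M b =
      c • NIMRep.mk M ((M.obj X).obj.obj b) := by
  have h : nimHom M (Gr.mk X) = nimOperator M X := Gr.liftRingHom_mk _ _ _ _ X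
  refine (extendScalars_tmul _ c (Gr.mk X) ((1 : K) ⊗ₜ[ℤ] Gr.mk b)).trans ?_
  change c • (LinearMap.baseChange K (nimHom M (Gr.mk X)) ((1 : K) ⊗ₜ[ℤ] Gr.mk b)) = _
  rw [h, LinearMap.baseChange_tmul, nimOperator_mk]
  rfl

end ModuleCategory

section Semisimple

attribute [local instance] Abelian.hasFiniteBiproducts

/-- A finite semisimple `K`-linear category: finite-dimensional morphism spaces, every object is a
finite direct sum of simple objects, and there are finitely many simple objects up to
isomorphism. -/
class IsFiniteSemisimple (K : Type w) [Field K] (B : Type u₁) [Category.{v₁} B] [Abelian B]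
    [Linear K B] : Prop where
  finite_hom : ∀ X Y : B, Module.Finite K (X ⟶ Y)
  semisimple : ∀ X : B, ∃ (n : ℕ) (T : Fin n → B), (∀ i, Simple (T i)) ∧ Nonempty (X ≅ ⨁ T)
  finite_simples : ∃ (n : ℕ) (T : Fin n → B), ∀ X : B, Simple X → ∃ i, Nonempty (X ≅ T i)

/-- A fusion category over `K`: a finite semisimple `K`-linear rigid monoidal category with
`K`-bilinear tensor product and simple unit. -/
class IsFusionCategory (K : Type w) [Field K] (C : Type u₁) [Category.{v₁} C] [Abelian C]
    [Linear K C] [MonoidalCategory C] [MonoidalPreadditive C] [MonoidalLinear K C]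
    [RigidCategory C] : Prop extends IsFiniteSemisimple K C where
  simple_unit : Simple (𝟙_ C)

/-- `S : ι → B` is a complete set of representatives `Irr(B)` of the simple objects of `B`. -/
structure IsCompleteSetOfSimples {B : Type u₁} [Category.{v₁} B] [HasZeroMorphisms B]
    {ι : Type*} (S : ι → B) : Prop where
  simple : ∀ i, Simple (S i)
  eq_of_iso : ∀ i j, Nonempty (S i ≅ S j) → i = j
  exists_iso : ∀ X : B, Simple X → ∃ i, Nonempty (X ≅ S i)

end Semisimple

section Comparison

variable {K : Type w} [Field K]
  {C : Type u₁} [Category.{v₁} C] [MonoidalCategory C] [RightRigidCategory C]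
  {B : Type u₂} [Category.{v₂} B] [Preadditive B] [Linear K B]

/-- The module category `M` is pivotal: the isomorphisms
`M(p_X) : M(X) ⟶ M(X^∨∨) = M(X)^∨∨` are natural with respect to *all* morphisms
`α : M(X) ⟶ M(Y)` of `End(B)`. Here `M(X^∨)` is taken as the dual of `M(X)`. -/
def IsPivotalModuleCategory (P : PivotalStructure C) (M : C ⥤ LinEnd K B) [M.Monoidal] : Prop :=
  ∀ (X Y : C) (α : M.obj X ⟶ M.obj Y),
    M.map (P.iso X).hom ≫ doubleMate (M.obj (dual X)) (M.obj (ddual X)) (M.obj (dual Y))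
      (M.obj (ddual Y)) α = α ≫ M.map (P.iso Y).hom

/-- For an object `A` of the idempotent completion `D` of the image of `M`, exhibited as a retract
of `M(X)`, the component `p_A : A ⟶ A^∨∨` of the pivotal structure on `D` induced by `M(p)`. -/
def inducedPivotal (P : PivotalStructure C) (M : C ⥤ LinEnd K B) [M.Monoidal] {A : LinEnd K B}
    {X : C} (r : Retract A (M.obj X)) (A' A'' : LinEnd K B) [ExactPairing A A']
    [ExactPairing A' A''] : A ⟶ A'' :=
  r.i ≫ M.map (P.iso X).hom ≫ doubleMate (M.obj (dual X)) (M.obj (ddual X)) A' A'' r.r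

variable {ι : Type*}

/-- `A` is the matrix unit `e_{ij}` of `End(B)`: it takes `S j` to `S i` and the other simple
objects to zero. -/
def IsMatrixUnit (S : ι → B) (i j : ι) (A : LinEnd K B) : Prop :=
  Nonempty (A.obj.obj (S j) ≅ S i) ∧ ∀ k, k ≠ j → IsZero (A.obj.obj (S k))

/-- `q : A ⟶ A^∨∨` is the component at `A` of the standard pivotal structure on `End(B)`.
An endofunctor `A` is the matrix of vector spaces `A_{ij} = Hom(S i, A(S j))`, and the standard
pivotal structure is the one whose categorical trace is the trace of matrices: for `f : A ⟶ A`,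
the trace of `f`, a natural endomorphism of `id_B`, acts on `S i` as the scalar `∑ j, tr(f_{ij})`.
In particular, every matrix unit has dimension one. -/
def IsStandardPivotal [Fintype ι] (S : ι → B) {A : LinEnd K B} (A' A'' : LinEnd K B)
    [ExactPairing A A'] [ExactPairing A' A''] (q : A ⟶ A'') : Prop :=
  ∀ (f : A ⟶ A) (i : ι), natApp (η_ A A' ≫ (f ≫ q) ▷ A' ≫ ε_ A' A'') (S i) =
    (∑ j, LinearMap.trace K (S i ⟶ A.obj.obj (S j))
      (Linear.rightComp K (S i) (f.hom.app (S j)))) • 𝟙 (S i)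

/-- The scalars `lam i` compare the pivotal structure `p` induced by `M` with the standard pivotal
structure `q` on `End(B)`: for every matrix unit `A = e_{ij}` lying in the idempotent completion of
the image of `M`, one has `p_A⁻¹ ∘ q_A = lam i / lam j`. -/
def ComparesPivotal [Fintype ι] (P : PivotalStructure C) (M : C ⥤ LinEnd K B) [M.Monoidal]
    (S : ι → B) (lam : ι → Kˣ) : Prop :=
  ∀ (i j : ι) (A : LinEnd K B), IsMatrixUnit S i j A →
    ∀ (X : C) (r : Retract A (M.obj X)) (A' A'' : LinEnd K B) [ExactPairing A A']
      [ExactPairing A' A''],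
      ∃ q : A ⟶ A'', IsStandardPivotal S A' A'' q ∧
        q = ((lam i : K) / (lam j : K)) • inducedPivotal P M r A' A''

end Comparison

end FusionModules

open FusionModules

/-! Write d_ij for the dimension of the matrix unit e_ij with respect to p. If e_ij is a summand of
M(X), then S i splits off M(X)(S j) through maps with u ≫ v = 𝟙, and d_ij is the scalar by which a
loop of M(X) carrying the idempotent v ≫ u acts on S i. Pivotality makes such traces cyclic for all
morphisms of End(B) (`loopTrace_cyclic`), so d_ij depends neither on X nor on u and v
(`loopTrace_matrixHom_eq`).

Since e_ij ⊗ e_jk ≅ e_ik, these dimensions multiply (`matrixUnitDim_mul`). Moreover d_ii = 1, and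
duality makes "e_ij lies in D" an equivalence relation on ι (`IsLinked.symm`). So d is a nowhere
vanishing multiplicative cocycle on an equivalence relation, hence a coboundary: d_ij = λ_j / λ_i
(`exists_matrixUnitDim_eq_div`). The standard structure gives e_ij dimension 1, so q = c p on e_ij
means c d_ij = 1; the families λ of the theorem are therefore exactly the trivialisations of d
(`comparesPivotal_iff`).

Encircling φ^j by M(X) places on the loop the idempotent that cuts out column j of M(X). This is a
sum of matrix-unit idempotents, one for each simple summand S i of M(X)(S j), so X · φ^j is the sum
of d_ij φ^i over these summands (`encircleBy_simpleProjection`). Sending φ^i to λ_i [i] turns each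
coefficient into d_ij λ_i = λ_j, and the sum becomes λ_j [M(X)(S j)], which is [X] acting on λ_j
[j]. -/

namespace FusionModules

universe w v₁ v₂ u₁ u₂

/-! ### Decomposition into simple objects and Schur's lemma. -/

section SemisimpleDecomposition

attribute [local instance] Abelian.hasFiniteBiproducts

variable {B : Type u₁} [Category.{v₁} B] [Abelian B]

/-- The class of a finite direct sum. -/
theorem Gr.mk_biproduct : ∀ {n : ℕ} (T : Fin n → B), Gr.mk (⨁ T) = ∑ k, Gr.mk (T k)
  | 0, T => by
    rw [Fin.sum_univ_zero]
    exact Gr.mk_zero ((IsZero.iff_id_eq_zero _).2 (biproduct.hom_ext _ _ fun j => j.elim0))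
  | n + 1, T => by
    -- The induction splits off the summand `T 0`: this bicone exhibits `⨁ T` as its direct sum with
    -- the tail.
    let b : BinaryBicone (T 0) (⨁ fun k : Fin n => T k.succ) :=
      { pt := ⨁ T
        fst := biproduct.π T 0
        snd := biproduct.lift fun k => biproduct.π T k.succ
        inl := biproduct.ι T 0
        inr := biproduct.desc fun k => biproduct.ι T k.succ
        inl_fst := by simp
        inl_snd := by ext k; simp [biproduct.ι_π_ne _ (Fin.succ_ne_zero k).symm]
        inr_fst := by ext k; simp [biproduct.ι_π_ne _ (Fin.succ_ne_zero k)]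
        inr_snd := by
          ext k l
          by_cases h : k = l
          · subst h; simp
          · simp [biproduct.ι_π_ne (fun k : Fin n => T k.succ) (Ne.symm h),
              biproduct.ι_π_ne T fun h' => h (Fin.succ_injective _ h').symm] }
    have hb : b.IsBilimit := isBinaryBilimitOfTotal b (by
      rw [← biproduct.total (f := T), Fin.sum_univ_succ]
      congr 1
      simp [b, biproduct.lift_desc])
    rw [Fin.sum_univ_succ, ← Gr.mk_biproduct (fun k : Fin n => T k.succ)]
    exact Gr.mk_add (biprod.uniqueUpToIso _ _ hb)

variable {K : Type w} [Field K] [Linear K B] [IsFiniteSemisimple K B] {ι : Type*} {S : ι → B}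

variable (K) in
include K in
/-- Every object is a finite direct sum of the chosen simple objects. -/
theorem IsCompleteSetOfSimples.exists_decomposition (hS : IsCompleteSetOfSimples S) (b : B) :
    ∃ (n : ℕ) (s : Fin n → ι) (p : ∀ k, b ⟶ S (s k)) (m : ∀ k, S (s k) ⟶ b),
      (∀ k, m k ≫ p k = 𝟙 _) ∧ ∑ k, p k ≫ m k = 𝟙 b ∧ Gr.mk b = ∑ k, Gr.mk (S (s k)) := by
  obtain ⟨n, T, hT, ⟨e⟩⟩ := IsFiniteSemisimple.semisimple (K := K) b
  choose s hs using fun k => hS.exists_iso (T k) (hT k)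
  have f : ∀ k, T k ≅ S (s k) := fun k => (hs k).some
  refine ⟨n, s, fun k => e.hom ≫ biproduct.π T k ≫ (f k).hom,
    fun k => (f k).inv ≫ biproduct.ι T k ≫ e.inv, fun k => by simp, ?_, ?_⟩
  · have h := congrArg (fun x => e.hom ≫ x ≫ e.inv) (biproduct.total (f := T))
    simp only [Preadditive.sum_comp, Preadditive.comp_sum, Category.assoc, Category.id_comp,
      Iso.hom_inv_id] at h
    simpa using h
  · rw [Gr.mk_congr e, Gr.mk_biproduct]
    exact Finset.sum_congr rfl fun k _ => Gr.mk_congr (f k)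

theorem IsCompleteSetOfSimples.hom_eq_zero (hS : IsCompleteSetOfSimples S) {i j : ι} (h : i ≠ j)
    (f : S i ⟶ S j) : f = 0 := by
  have := hS.simple i
  have := hS.simple j
  by_contra hf
  have := isIso_of_hom_simple hf
  exact h (hS.eq_of_iso i j ⟨asIso f⟩)

variable (K) in
include K in
/-- A nonzero morphism to a chosen simple object is a split epimorphism. -/
theorem IsCompleteSetOfSimples.exists_section (hS : IsCompleteSetOfSimples S) {i : ι} {b : B}
    {f : b ⟶ S i} (hf : f ≠ 0) : ∃ g : S i ⟶ b, g ≫ f = 𝟙 _ := by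
  obtain ⟨n, s, p, m, -, hpm, -⟩ := hS.exists_decomposition K b
  have : ∃ k, m k ≫ f ≠ 0 := by
    by_contra! h
    apply hf
    rw [← Category.id_comp f, ← hpm, Preadditive.sum_comp]
    exact Finset.sum_eq_zero fun k _ => by rw [Category.assoc, h, comp_zero]
  obtain ⟨k, hk⟩ := this
  have := hS.simple i
  have := hS.simple (s k)
  have := isIso_of_hom_simple hk
  exact ⟨inv (m k ≫ f) ≫ m k, by rw [Category.assoc, IsIso.inv_hom_id]⟩

theorem IsCompleteSetOfSimples.exists_smul_id [IsAlgClosed K] (hS : IsCompleteSetOfSimples S)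
    {i : ι} (f : S i ⟶ S i) : ∃ c : K, f = c • 𝟙 (S i) := by
  have := hS.simple i
  have := IsFiniteSemisimple.finite_hom (K := K) (S i) (S i)
  obtain ⟨c, hc⟩ := endomorphism_simple_eq_smul_id K f
  exact ⟨c, hc.symm⟩

omit [IsFiniteSemisimple K B] in
theorem IsCompleteSetOfSimples.smul_id_injective (hS : IsCompleteSetOfSimples S)
    {i : ι} {c d : K} (h : c • 𝟙 (S i) = d • 𝟙 (S i)) : c = d := by
  have := hS.simple i
  exact smul_left_injective K (id_nonzero (S i)) h

end SemisimpleDecomposition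

/-! ### Morphisms of End(B) as families of components at the simple objects. -/

section Matrices

variable {K : Type w} [Field K] {B : Type u₁} [Category.{v₁} B] [Abelian B] [Linear K B]

theorem LinEnd.comp_app {V W U : LinEnd K B} (f : V ⟶ W) (g : W ⟶ U) (b : B) :
    (f ≫ g).hom.app b = f.hom.app b ≫ g.hom.app b := rfl

theorem LinEnd.id_app (V : LinEnd K B) (b : B) : (𝟙 V : V ⟶ V).hom.app b = 𝟙 _ := rfl

theorem LinEnd.smul_app {V W : LinEnd K B} (c : K) (f : V ⟶ W) (b : B) :
    (c • f).hom.app b = c • f.hom.app b := rfl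

/-- Evaluation of natural transformations at an object. -/
def LinEnd.appHom (V W : LinEnd K B) (b : B) : (V ⟶ W) →+ (V.obj.obj b ⟶ W.obj.obj b) where
  toFun f := f.hom.app b
  map_zero' := rfl
  map_add' _ _ := rfl

theorem LinEnd.sum_app {V W : LinEnd K B} {τ : Type*} (s : Finset τ) (f : τ → (V ⟶ W)) (b : B) :
    (∑ k ∈ s, f k).hom.app b = ∑ k ∈ s, (f k).hom.app b :=
  map_sum (LinEnd.appHom V W b) f s

theorem LinEnd.naturality {V W : LinEnd K B} (f : V ⟶ W) {a b : B} (g : a ⟶ b) :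
    V.obj.map g ≫ f.hom.app b = f.hom.app a ≫ W.obj.map g := f.hom.naturality g

theorem LinEnd.map_zero (V : LinEnd K B) (a b : B) : V.obj.map (0 : a ⟶ b) = 0 := by
  have := V.property.1
  exact V.obj.map_zero _ _

theorem LinEnd.map_smul (V : LinEnd K B) {a b : B} (c : K) (f : a ⟶ b) :
    V.obj.map (c • f) = c • V.obj.map f := by
  have := V.property.2
  exact V.obj.map_smul c f

theorem LinEnd.map_sum (V : LinEnd K B) {τ : Type*} (s : Finset τ) {a b : B} (f : τ → (a ⟶ b)) :
    V.obj.map (∑ k ∈ s, f k) = ∑ k ∈ s, V.obj.map (f k) := by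
  have := V.property.1
  exact V.obj.map_sum f s

variable [IsFiniteSemisimple K B] {ι : Type*} {S : ι → B}

omit [IsFiniteSemisimple K B] in
theorem LinEnd.sum_map_decomposition (V : LinEnd K B) {b : B} {n : ℕ} {s : Fin n → ι}
    {p : ∀ k, b ⟶ S (s k)} {m : ∀ k, S (s k) ⟶ b} (h : ∑ k, p k ≫ m k = 𝟙 b) :
    ∑ k, V.obj.map (p k) ≫ V.obj.map (m k) = 𝟙 (V.obj.obj b) := by
  simp_rw [← Functor.map_comp]
  rw [← V.map_sum, h, CategoryTheory.Functor.map_id]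

/-- A natural transformation is determined by its components at the simple objects. -/
theorem LinEnd.hom_ext_simples (hS : IsCompleteSetOfSimples S) {V W : LinEnd K B} {f g : V ⟶ W}
    (h : ∀ j, f.hom.app (S j) = g.hom.app (S j)) : f = g := by
  ext b
  obtain ⟨n, s, p, m, -, hpm, -⟩ := hS.exists_decomposition K b
  rw [← Category.id_comp (f.hom.app b), ← Category.id_comp (g.hom.app b),
    ← V.sum_map_decomposition hpm, Preadditive.sum_comp, Preadditive.sum_comp]
  refine Finset.sum_congr rfl fun k _ => ?_
  rw [Category.assoc, Category.assoc, LinEnd.naturality, LinEnd.naturality, h]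

variable [IsAlgClosed K]

/-- Arbitrary components at the simple objects extend to a natural transformation. -/
theorem LinEnd.exists_hom (hS : IsCompleteSetOfSimples S) (V W : LinEnd K B)
    (g : ∀ j, V.obj.obj (S j) ⟶ W.obj.obj (S j)) : ∃ f : V ⟶ W, ∀ j, f.hom.app (S j) = g j := by
  -- Between simple objects naturality is automatic: by Schur's lemma a morphism is a scalar or
  -- zero.
  have hg : ∀ {i j : ι} (h : S i ⟶ S j), V.obj.map h ≫ g j = g i ≫ W.obj.map h := by
    intro i j h
    by_cases hij : i = j
    · subst hij
      obtain ⟨c, rfl⟩ := hS.exists_smul_id (K := K) h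
      simp [LinEnd.map_smul]
    · rw [hS.hom_eq_zero hij h, LinEnd.map_zero, LinEnd.map_zero, zero_comp, comp_zero]
  choose n s p m hmp hpm _ using hS.exists_decomposition K
  have key : ∀ {a b : B} (h : a ⟶ b),
      V.obj.map h ≫ ∑ l, V.obj.map (p b l) ≫ g (s b l) ≫ W.obj.map (m b l) =
        (∑ k, V.obj.map (p a k) ≫ g (s a k) ≫ W.obj.map (m a k)) ≫ W.obj.map h := by
    intro a b h
    -- Naturality for general h is checked on its matrix entries between the simple summands of a
    -- and b.
    have h1 : ∀ k l, V.obj.map (m a k ≫ h ≫ p b l) ≫ g (s b l) =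
        g (s a k) ≫ W.obj.map (m a k ≫ h ≫ p b l) := fun k l => hg _
    simp only [Functor.map_comp, Category.assoc] at h1
    calc _ = ∑ l, ∑ k, V.obj.map (p a k) ≫ V.obj.map (m a k) ≫ V.obj.map h ≫ V.obj.map (p b l) ≫
          g (s b l) ≫ W.obj.map (m b l) := by
          rw [Preadditive.comp_sum]
          refine Finset.sum_congr rfl fun l _ => ?_
          have := congrArg (· ≫ V.obj.map h ≫ V.obj.map (p b l) ≫
            g (s b l) ≫ W.obj.map (m b l)) (V.sum_map_decomposition (hpm a))
          simp only [Preadditive.sum_comp, Category.assoc, Category.id_comp] at this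
          exact this.symm
      _ = ∑ k, ∑ l, V.obj.map (p a k) ≫ g (s a k) ≫ W.obj.map (m a k) ≫ W.obj.map h ≫
          W.obj.map (p b l) ≫ W.obj.map (m b l) := by
          rw [Finset.sum_comm]
          refine Finset.sum_congr rfl fun k _ => Finset.sum_congr rfl fun l _ => ?_
          rw [reassoc_of% h1 k l]
      _ = _ := by
          rw [Preadditive.sum_comp]
          refine Finset.sum_congr rfl fun k _ => ?_
          have := congrArg (fun x => V.obj.map (p a k) ≫ g (s a k) ≫ W.obj.map (m a k) ≫
            W.obj.map h ≫ x) (W.sum_map_decomposition (hpm b))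
          simpa only [Preadditive.comp_sum, Category.assoc, Category.comp_id] using this
  refine ⟨ObjectProperty.homMk
    { app := fun b => ∑ k, V.obj.map (p b k) ≫ g (s b k) ≫ W.obj.map (m b k)
      naturality := fun a b h => key h }, fun j => ?_⟩
  change ∑ k, V.obj.map (p (S j) k) ≫ g (s (S j) k) ≫ W.obj.map (m (S j) k) = g j
  -- The decomposition chosen for `S j` need not be the trivial one; `hg` moves `g j` to the front
  -- and the sum collapses.
  have := congrArg (g j ≫ ·) (W.sum_map_decomposition (hpm (S j)))
  simp only [Preadditive.comp_sum, Category.comp_id] at this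
  rw [← this]
  refine Finset.sum_congr rfl fun k _ => ?_
  rw [reassoc_of% hg (p (S j) k)]

variable [DecidableEq ι]

/-- The natural transformation with component `g` at `S j` which is zero at the other simple
objects. -/
noncomputable def matrixHom (hS : IsCompleteSetOfSimples S) (V W : LinEnd K B) {j : ι}
    (g : V.obj.obj (S j) ⟶ W.obj.obj (S j)) : V ⟶ W :=
  (LinEnd.exists_hom hS V W
    (Pi.single (M := fun k => V.obj.obj (S k) ⟶ W.obj.obj (S k)) j g)).choose

variable (hS : IsCompleteSetOfSimples S)
include hS

theorem matrixHom_app (V W : LinEnd K B) {j : ι} (g : V.obj.obj (S j) ⟶ W.obj.obj (S j)) :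
    (matrixHom hS V W g).hom.app (S j) = g :=
  ((LinEnd.exists_hom hS V W _).choose_spec j).trans (Pi.single_eq_same (M := fun k => V.obj.obj (S k) ⟶ W.obj.obj (S k)) j g)

theorem matrixHom_app_of_ne (V W : LinEnd K B) {j k : ι} (h : k ≠ j)
    (g : V.obj.obj (S j) ⟶ W.obj.obj (S j)) : (matrixHom hS V W g).hom.app (S k) = 0 :=
  ((LinEnd.exists_hom hS V W _).choose_spec k).trans (Pi.single_eq_of_ne (M := fun k => V.obj.obj (S k) ⟶ W.obj.obj (S k)) h g)

theorem eq_matrixHom {V W : LinEnd K B} {j : ι} {f : V ⟶ W}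
    {g : V.obj.obj (S j) ⟶ W.obj.obj (S j)} (h : f.hom.app (S j) = g)
    (h' : ∀ k, k ≠ j → f.hom.app (S k) = 0) : f = matrixHom hS V W g := by
  refine LinEnd.hom_ext_simples hS fun k => ?_
  by_cases hk : k = j
  · subst hk; rw [h, matrixHom_app]
  · rw [h' k hk, matrixHom_app_of_ne hS _ _ hk]

theorem matrixHom_comp (V W U : LinEnd K B) {j : ι} (g : V.obj.obj (S j) ⟶ W.obj.obj (S j))
    (h : W.obj.obj (S j) ⟶ U.obj.obj (S j)) :
    matrixHom hS V W g ≫ matrixHom hS W U h = matrixHom hS V U (g ≫ h) := by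
  refine eq_matrixHom hS ?_ fun k hk => ?_
  · rw [LinEnd.comp_app, matrixHom_app, matrixHom_app]
  · rw [LinEnd.comp_app, matrixHom_app_of_ne hS _ _ hk, zero_comp]

theorem matrixHom_sum (V W : LinEnd K B) {j : ι} {τ : Type*} (s : Finset τ)
    (g : τ → (V.obj.obj (S j) ⟶ W.obj.obj (S j))) :
    matrixHom hS V W (∑ k ∈ s, g k) = ∑ k ∈ s, matrixHom hS V W (g k) := by
  symm
  refine eq_matrixHom hS ?_ fun k hk => ?_
  · rw [LinEnd.sum_app]
    exact Finset.sum_congr rfl fun k _ => matrixHom_app hS _ _ _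
  · rw [LinEnd.sum_app]
    exact Finset.sum_eq_zero fun k _ => matrixHom_app_of_ne hS _ _ hk _

/-- If `g` factors through `S i`, then all components of `matrixHom g` vanish on maps from `S k`,
`k ≠ i`. -/
theorem comp_matrixHom_app_eq_zero (V W : LinEnd K B) {i j k : ι} (hk : k ≠ i)
    (v : V.obj.obj (S j) ⟶ S i) (u : S i ⟶ W.obj.obj (S j)) {b : B} (x : S k ⟶ V.obj.obj b) :
    x ≫ (matrixHom hS V W (v ≫ u)).hom.app b = 0 := by
  obtain ⟨n, s, p, m, -, hpm, -⟩ := hS.exists_decomposition K b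
  rw [← Category.id_comp ((matrixHom hS V W (v ≫ u)).hom.app b), ← V.sum_map_decomposition hpm,
    Preadditive.sum_comp, Preadditive.comp_sum]
  refine Finset.sum_eq_zero fun l _ => ?_
  rw [Category.assoc, LinEnd.naturality]
  by_cases hl : s l = j
  -- The index is generalised to t because `s l` cannot be substituted. At `S j` the composite
  -- passes through a map `S k ⟶ S i`, which vanishes.
  · have : ∀ (t : ι) (ht : t = j) (q : S k ⟶ V.obj.obj (S t)),
        q ≫ (matrixHom hS V W (v ≫ u)).hom.app (S t) = 0 := by
      rintro t rfl q
      rw [matrixHom_app, ← Category.assoc, hS.hom_eq_zero hk (q ≫ v), zero_comp]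
    rw [← Category.assoc, ← Category.assoc, this _ hl, zero_comp]
  · rw [matrixHom_app_of_ne hS _ _ hl, zero_comp, comp_zero, comp_zero]

/-- The natural endomorphism of `id_B` with component the identity at `S i` and zero at the other
simple objects. -/
noncomputable def simpleProjection (i : ι) : 𝟙_ (LinEnd K B) ⟶ 𝟙_ (LinEnd K B) :=
  matrixHom hS (𝟙_ (LinEnd K B)) (𝟙_ (LinEnd K B)) (𝟙 (S i))

theorem natApp_simpleProjection (i j : ι) :
    natApp (simpleProjection (K := K) hS i) (S j) = if i = j then 𝟙 (S j) else 0 := by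
  split_ifs with h
  · subst h; exact matrixHom_app hS _ _ _
  · exact matrixHom_app_of_ne hS _ _ (Ne.symm h) _

theorem natApp_sum_simpleProjection [Fintype ι] (c : ι → K) (j : ι) :
    natApp (∑ i, c i • simpleProjection (K := K) hS i) (S j) = c j • 𝟙 (S j) := by
  change (∑ i, c i • simpleProjection (K := K) hS i).hom.app (S j) = _
  rw [LinEnd.sum_app, Finset.sum_eq_single j]
  · rw [LinEnd.smul_app]
    exact congrArg (c j • ·) ((natApp_simpleProjection hS j j).trans (if_pos rfl))
  · intro i _ hi
    rw [LinEnd.smul_app]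
    exact (congrArg (c i • ·) ((natApp_simpleProjection hS i j).trans (if_neg hi))).trans
      (smul_zero _)
  · simp

omit [DecidableEq ι] in
theorem exists_natApp_eq_smul (α : 𝟙_ (LinEnd K B) ⟶ 𝟙_ (LinEnd K B)) (i : ι) :
    ∃ c : K, natApp α (S i) = c • 𝟙 (S i) :=
  hS.exists_smul_id (natApp α (S i))

omit [IsAlgClosed K] [DecidableEq ι] in
theorem natApp_ext {α β : 𝟙_ (LinEnd K B) ⟶ 𝟙_ (LinEnd K B)}
    (h : ∀ i, natApp α (S i) = natApp β (S i)) : α = β :=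
  LinEnd.hom_ext_simples hS h

/-- The basis of `Nat(id_B)` given by the projections to the simple objects. -/
noncomputable def natBasis [Fintype ι] :
    Module.Basis ι K (𝟙_ (LinEnd K B) ⟶ 𝟙_ (LinEnd K B)) :=
  Module.Basis.mk (v := simpleProjection hS)
    (Fintype.linearIndependent_iff.2 fun c hc j => by
      have h := natApp_sum_simpleProjection hS c j
      rw [hc] at h
      exact hS.smul_id_injective (h.symm.trans (zero_smul K (𝟙 (S j))).symm))
    (fun α _ => by
      choose c hc using exists_natApp_eq_smul hS α
      have : α = ∑ i, c i • simpleProjection hS i :=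
        natApp_ext hS fun j => (hc j).trans (natApp_sum_simpleProjection hS c j).symm
      rw [this]
      exact Submodule.sum_mem _ fun i _ =>
        Submodule.smul_mem _ _ (Submodule.subset_span ⟨i, rfl⟩))

theorem natBasis_apply [Fintype ι] (i : ι) : natBasis (K := K) hS i = simpleProjection hS i :=
  Module.Basis.mk_apply _ _ i

end Matrices

/-! ### Encircling as a trace. -/

section Encircle

variable {K : Type w} [Field K] {B : Type u₁} [Category.{v₁} B] [Abelian B] [Linear K B]

theorem LinEnd.tensorHom_app {V V' W W' : LinEnd K B} (f : V ⟶ V') (g : W ⟶ W') (b : B) :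
    (f ⊗ₘ g).hom.app b = f.hom.app (W.obj.obj b) ≫ V'.obj.map (g.hom.app b) := rfl

/-- The endomorphism `V(α)` of `V` for a natural endomorphism `α` of `id_B`. -/
def innerAction (V : LinEnd K B) (α : 𝟙_ (LinEnd K B) ⟶ 𝟙_ (LinEnd K B)) : V ⟶ V :=
  (ρ_ V).inv ≫ V ◁ α ≫ (ρ_ V).hom

theorem innerAction_app (V : LinEnd K B) (α : 𝟙_ (LinEnd K B) ⟶ 𝟙_ (LinEnd K B)) (b : B) :
    (innerAction V α).hom.app b = V.obj.map (natApp α b) :=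
  (Category.id_comp _).trans (Category.comp_id _)

variable {V V' V'' : LinEnd K B} [ExactPairing V V'] [ExactPairing V' V'']

theorem natApp_encircle (p : V ⟶ V'') (α : 𝟙_ (LinEnd K B) ⟶ 𝟙_ (LinEnd K B)) (b : B) :
    natApp (encircle V' V'' p α) b = (η_ V V').hom.app b ≫ p.hom.app (V'.obj.obj b) ≫
      V''.obj.map (natApp α (V'.obj.obj b)) ≫ (ε_ V' V'').hom.app b := by
  have h : ((λ_ V').inv ≫ α ▷ V' ≫ (λ_ V').hom).hom.app b = natApp α (V'.obj.obj b) :=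
    (Category.id_comp _).trans (Category.comp_id _)
  rw [encircle_eq, ← h]
  rfl

/-- Naturality of p lets α be absorbed into the strand as the endomorphism V(α), which reduces
encircling α to a trace with nothing inside the loop. -/
theorem encircle_eq_innerAction (p : V ⟶ V'') (α : 𝟙_ (LinEnd K B) ⟶ 𝟙_ (LinEnd K B)) :
    encircle V' V'' p α = encircle V' V'' (innerAction V α ≫ p) (𝟙 _) := by
  ext b
  have h1 := natApp_encircle (V' := V') p α b
  have h2 := natApp_encircle (V' := V') (innerAction V α ≫ p) (𝟙 _) b
  refine h1.trans (Eq.trans ?_ h2.symm)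
  have h3 : natApp (𝟙 (𝟙_ (LinEnd K B))) (V'.obj.obj b) = 𝟙 _ := rfl
  rw [h3, CategoryTheory.Functor.map_id, Category.id_comp, LinEnd.comp_app, innerAction_app,
    Category.assoc, ← Category.assoc (V.obj.map _), LinEnd.naturality, Category.assoc]

theorem encircle_id_right (p : V ⟶ V'') :
    encircle V' V'' p (𝟙 _) = η_ V V' ≫ p ▷ V' ≫ ε_ V' V'' := by
  simp [encircle_eq]

theorem encircle_smul_left (p : V ⟶ V'') (c : K) (α : 𝟙_ (LinEnd K B) ⟶ 𝟙_ (LinEnd K B)) :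
    encircle V' V'' (c • p) α = c • encircle V' V'' p α := by
  simp [encircle_eq]

theorem encircle_sum_left {τ : Type*} (s : Finset τ) (p : τ → (V ⟶ V''))
    (α : 𝟙_ (LinEnd K B) ⟶ 𝟙_ (LinEnd K B)) :
    encircle V' V'' (∑ k ∈ s, p k) α = ∑ k ∈ s, encircle V' V'' (p k) α :=
  map_sum (AddMonoidHom.mk' (fun p => encircle V' V'' p α)
    fun p q => encircle_add_left p q α) p s

end Encircle

/-! ### Loop traces and the dimensions of matrix units. -/

section Loops

variable {K : Type w} [Field K]
  {C : Type u₁} [Category.{v₁} C] [MonoidalCategory C] [RightRigidCategory C]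
  {B : Type u₂} [Category.{v₂} B] [Abelian B] [Linear K B]

/-- The trace of an endomorphism of `M(X)` with respect to `M(p)`. -/
def loopTrace (P : PivotalStructure C) (M : C ⥤ LinEnd K B) [M.Monoidal] {X : C}
    (f : M.obj X ⟶ M.obj X) : 𝟙_ (LinEnd K B) ⟶ 𝟙_ (LinEnd K B) :=
  encircle (M.obj (dual X)) (M.obj (ddual X)) (f ≫ M.map (P.iso X).hom) (𝟙 _)

variable (P : PivotalStructure C) (M : C ⥤ LinEnd K B) [M.Monoidal]

theorem loopTrace_sum {X : C} {τ : Type*} (s : Finset τ) (f : τ → (M.obj X ⟶ M.obj X)) :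
    loopTrace P M (∑ k ∈ s, f k) = ∑ k ∈ s, loopTrace P M (f k) := by
  unfold loopTrace
  rw [Preadditive.sum_comp, encircle_sum_left]

/-- Moving f round the loop replaces it by its double dual, and the pivotality of M turns that back
into f. This is where naturality with respect to morphisms outside the image of M enters. -/
theorem loopTrace_cyclic {P : PivotalStructure C} {M : C ⥤ LinEnd K B} [M.Monoidal]
    (hM : IsPivotalModuleCategory P M) {X Y : C} (f : M.obj X ⟶ M.obj Y)
    (g : M.obj Y ⟶ M.obj X) : loopTrace P M (f ≫ g) = loopTrace P M (g ≫ f) := by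
  unfold loopTrace
  rw [Category.assoc, encircle_cyclic (W' := M.obj (dual Y)) (W'' := M.obj (ddual Y)),
    Category.assoc, hM, Category.assoc]

theorem loopTrace_unit (f : 𝟙_ (LinEnd K B) ⟶ 𝟙_ (LinEnd K B)) :
    loopTrace P M (Functor.OplaxMonoidal.η M ≫ f ≫ Functor.LaxMonoidal.ε M) = f := by
  unfold loopTrace
  -- Cyclicity along an identity changes the chosen dual of the unit into the unit itself; cyclicity
  -- along `η M` then moves the loop to the unit of End(B).
  rw [← Category.id_comp ((Functor.OplaxMonoidal.η M ≫ f ≫ Functor.LaxMonoidal.ε M) ≫ _),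
    ← M.map_id, encircle_cyclic (W' := M.obj (𝟙_ C)) (W'' := M.obj (𝟙_ C)), ← map_doubleMate,
    Category.assoc, ← M.map_comp, P.unit, M.map_id, Category.comp_id,
    encircle_cyclic (W' := 𝟙_ _) (W'' := 𝟙_ _), doubleMate_η, Category.assoc,
    Functor.Monoidal.ε_η, Category.comp_id, ← Category.id_comp (𝟙 (𝟙_ (LinEnd K B)))]
  have h := encircle_eq_innerAction (V := 𝟙_ (LinEnd K B)) (V' := 𝟙_ _) (V'' := 𝟙_ _) (𝟙 _) f
  rw [encircle_unit, Category.comp_id] at h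
  have h' : innerAction (𝟙_ (LinEnd K B)) f = f := by
    ext b; exact innerAction_app _ f b
  rw [h'] at h
  simpa using h.symm

/-- A loop labelled by a tensor product is a pair of nested loops. As for the unit, cyclicity along
an identity and along the structure map of M first adjusts the duals. -/
theorem loopTrace_tensor {X Y : C} (f : M.obj X ⟶ M.obj X) (g : M.obj Y ⟶ M.obj Y) :
    loopTrace P M (Functor.OplaxMonoidal.δ M X Y ≫ (f ⊗ₘ g) ≫ Functor.LaxMonoidal.μ M X Y) =
      encircle (M.obj (dual X)) (M.obj (ddual X)) (f ≫ M.map (P.iso X).hom) (loopTrace P M g) := by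
  unfold loopTrace
  rw [← Category.id_comp ((Functor.OplaxMonoidal.δ M X Y ≫ _) ≫ _), ← M.map_id,
    encircle_cyclic (W' := M.obj (dual Y ⊗ dual X)) (W'' := M.obj (ddual X ⊗ ddual Y)),
    ← map_doubleMate, Category.assoc, ← M.map_comp, P.tensor, Functor.Monoidal.map_tensor,
    Category.assoc,
    encircle_cyclic (W' := M.obj (dual Y) ⊗ M.obj (dual X))
      (W'' := M.obj (ddual X) ⊗ M.obj (ddual Y)),
    doubleMate_δ, ← encircle_tensor]
  simp only [Category.assoc, Functor.Monoidal.μ_δ_assoc, Functor.Monoidal.μ_δ, Category.comp_id,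
    tensorHom_comp_tensorHom]

variable [IsFiniteSemisimple K B] [IsAlgClosed K] {ι : Type*} [DecidableEq ι] {S : ι → B}
  (hS : IsCompleteSetOfSimples S)

/-- At `S k` the loop begins with the coevaluation followed by a component of `matrixHom`. For k ≠ i
this vanishes since v ≫ u factors through `S i`; at `S i` Schur's lemma leaves a scalar. -/
theorem exists_loopTrace_matrixHom {X : C} {i j : ι} (v : (M.obj X).obj.obj (S j) ⟶ S i)
    (u : S i ⟶ (M.obj X).obj.obj (S j)) :
    ∃ d : K, loopTrace P M (matrixHom hS _ _ (v ≫ u)) = d • simpleProjection hS i := by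
  obtain ⟨d, hd⟩ := exists_natApp_eq_smul hS (loopTrace P M (matrixHom hS _ _ (v ≫ u))) i
  refine ⟨d, natApp_ext hS fun k => ?_⟩
  have h : natApp (d • simpleProjection (K := K) hS i) (S k) =
    d • natApp (simpleProjection (K := K) hS i) (S k) := rfl
  rw [h, natApp_simpleProjection]
  by_cases hk : i = k
  · subst hk; rw [if_pos rfl, hd]
  · rw [if_neg hk, smul_zero]
    unfold loopTrace
    rw [natApp_encircle, LinEnd.comp_app, Category.assoc, ← Category.assoc]
    exact (congrArg (· ≫ _) (comp_matrixHom_app_eq_zero hS _ _ (Ne.symm hk) v u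
      ((η_ (M.obj X) (M.obj (dual X))).hom.app (S k)))).trans zero_comp

/-- The dimension of `e_{ij}` does not depend on how it is exhibited as a direct summand. -/
theorem loopTrace_matrixHom_eq {P : PivotalStructure C} {M : C ⥤ LinEnd K B} [M.Monoidal]
    (hM : IsPivotalModuleCategory P M) {i j : ι} {X Y : C}
    {u : S i ⟶ (M.obj X).obj.obj (S j)} {v : (M.obj X).obj.obj (S j) ⟶ S i}
    {u' : S i ⟶ (M.obj Y).obj.obj (S j)} {v' : (M.obj Y).obj.obj (S j) ⟶ S i}
    (h : u ≫ v = 𝟙 _) (h' : u' ≫ v' = 𝟙 _) :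
    loopTrace P M (matrixHom hS _ _ (v ≫ u)) = loopTrace P M (matrixHom hS _ _ (v' ≫ u')) := by
  -- The two idempotents are the products, in the two orders, of maps between M(X)(S j) and M(Y)(S
  -- j), so cyclicity identifies their traces.
  have h1 : v ≫ u = (v ≫ u') ≫ (v' ≫ u) := by
    rw [Category.assoc, reassoc_of% h']
  have h2 : v' ≫ u' = (v' ≫ u) ≫ (v ≫ u') := by
    rw [Category.assoc, reassoc_of% h]
  rw [h1, h2, ← matrixHom_comp hS _ (M.obj Y), ← matrixHom_comp hS _ (M.obj X),
    loopTrace_cyclic hM]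

/-- The matrix unit `e_{ij}` is a direct summand of some `M(X)`. -/
def IsLinked (M : C ⥤ LinEnd K B) (S : ι → B) (i j : ι) : Prop :=
  ∃ (X : C) (u : S i ⟶ (M.obj X).obj.obj (S j)) (v : (M.obj X).obj.obj (S j) ⟶ S i), u ≫ v = 𝟙 _

theorem exists_matrixUnitDim {P : PivotalStructure C} {M : C ⥤ LinEnd K B} [M.Monoidal]
    (hM : IsPivotalModuleCategory P M) (i j : ι) :
    ∃ d : K, ∀ (X : C) (u : S i ⟶ (M.obj X).obj.obj (S j)) (v : (M.obj X).obj.obj (S j) ⟶ S i),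
      u ≫ v = 𝟙 _ →
        loopTrace P M (matrixHom hS _ _ (v ≫ u)) = d • simpleProjection hS i := by
  by_cases h : IsLinked M S i j
  · obtain ⟨X, u, v, huv⟩ := h
    obtain ⟨d, hd⟩ := exists_loopTrace_matrixHom P M hS v u
    exact ⟨d, fun Y u' v' h' => (loopTrace_matrixHom_eq hS hM h' huv).trans hd⟩
  -- If e_ij is not a summand of any M(X) the condition is vacuous, and 0 is a junk value.
  · exact ⟨0, fun X u v huv => absurd ⟨X, u, v, huv⟩ h⟩

/-- The dimension of the matrix unit `e_{ij}` with respect to the pivotal structure induced by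
`M`, if it is a direct summand of some `M(X)`. -/
noncomputable def matrixUnitDim {P : PivotalStructure C} {M : C ⥤ LinEnd K B} [M.Monoidal]
    (hM : IsPivotalModuleCategory P M) (i j : ι) : K :=
  (exists_matrixUnitDim hS hM i j).choose

variable {P M} (hM : IsPivotalModuleCategory P M)

theorem loopTrace_matrixHom {i j : ι} {X : C} {u : S i ⟶ (M.obj X).obj.obj (S j)}
    {v : (M.obj X).obj.obj (S j) ⟶ S i} (h : u ≫ v = 𝟙 _) :
    loopTrace P M (matrixHom hS _ _ (v ≫ u)) = matrixUnitDim hS hM i j • simpleProjection hS i :=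
  (exists_matrixUnitDim hS hM i j).choose_spec X u v h

/-- Because the dimension is independent of the splitting, it may be read off from any single one.
-/
theorem matrixUnitDim_eq {i j : ι} {X : C} {u : S i ⟶ (M.obj X).obj.obj (S j)}
    {v : (M.obj X).obj.obj (S j) ⟶ S i} (h : u ≫ v = 𝟙 _) {d : K}
    (hd : loopTrace P M (matrixHom hS _ _ (v ≫ u)) = d • simpleProjection hS i) :
    matrixUnitDim hS hM i j = d := by
  rw [loopTrace_matrixHom hS hM h] at hd
  have h1 := congrArg (fun α => natApp α (S i)) hd
  have h2 : ∀ c : K, natApp (c • simpleProjection (K := K) hS i) (S i) = c • 𝟙 (S i) := fun c =>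
    congrArg (c • ·) ((natApp_simpleProjection hS i i).trans (if_pos rfl))
  exact hS.smul_id_injective ((h2 _).symm.trans (h1.trans (h2 d)))

omit [RightRigidCategory C] [IsFiniteSemisimple K B] [IsAlgClosed K] [DecidableEq ι] in
variable (M S) in
theorem isLinked_refl (i : ι) : IsLinked M S i i :=
  ⟨𝟙_ C, (Functor.LaxMonoidal.ε M).hom.app (S i), (Functor.OplaxMonoidal.η M).hom.app (S i), by
    rw [← LinEnd.comp_app, Functor.Monoidal.ε_η]; rfl⟩

/-- M(𝟙) is isomorphic to the identity functor, so e_ii splits off it through `ε` and `η`; its trace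
is given by `loopTrace_unit`. -/
theorem matrixUnitDim_self (i : ι) : matrixUnitDim hS hM i i = 1 := by
  refine matrixUnitDim_eq hS hM (X := 𝟙_ C) (u := (Functor.LaxMonoidal.ε M).hom.app (S i))
    (v := (Functor.OplaxMonoidal.η M).hom.app (S i)) ?_ ?_
  · rw [← LinEnd.comp_app, Functor.Monoidal.ε_η]; rfl
  · rw [one_smul, ← loopTrace_unit P M (simpleProjection hS i)]
    congr 1
    symm
    refine eq_matrixHom hS ?_ fun k hk => ?_
    · have h : (simpleProjection (K := K) hS i).hom.app (S i) = 𝟙 _ := matrixHom_app hS _ _ _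
      rw [LinEnd.comp_app, LinEnd.comp_app, h]
      exact congrArg (_ ≫ ·) (Category.id_comp _)
    · have h : (simpleProjection (K := K) hS i).hom.app (S k) = 0 :=
        matrixHom_app_of_ne hS _ _ hk _
      rw [LinEnd.comp_app, LinEnd.comp_app, h, zero_comp, comp_zero]

section Composition

variable {i j k : ι} {X Y : C} (u : S i ⟶ (M.obj X).obj.obj (S j))
  (v : (M.obj X).obj.obj (S j) ⟶ S i) (u' : S j ⟶ (M.obj Y).obj.obj (S k))
  (v' : (M.obj Y).obj.obj (S k) ⟶ S j)

/-- The inclusion of `e_{ij} ⊗ e_{jk}` into `M(X ⊗ Y)`. -/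
def composeInclusion : S i ⟶ (M.obj (X ⊗ Y)).obj.obj (S k) :=
  u ≫ (M.obj X).obj.map u' ≫ (Functor.LaxMonoidal.μ M X Y).hom.app (S k)

/-- The projection of `M(X ⊗ Y)` to `e_{ij} ⊗ e_{jk}`. -/
def composeProjection : (M.obj (X ⊗ Y)).obj.obj (S k) ⟶ S i :=
  (Functor.OplaxMonoidal.δ M X Y).hom.app (S k) ≫ (M.obj X).obj.map v' ≫ v

omit [RightRigidCategory C] [IsFiniteSemisimple K B] [IsAlgClosed K] [DecidableEq ι] in
theorem composeInclusion_comp_composeProjection (h : u ≫ v = 𝟙 _) (h' : u' ≫ v' = 𝟙 _) :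
    composeInclusion u u' ≫ composeProjection v v' = 𝟙 _ := by
  have h1 : (Functor.LaxMonoidal.μ M X Y).hom.app (S k) ≫
      (Functor.OplaxMonoidal.δ M X Y).hom.app (S k) = 𝟙 _ := by
    rw [← LinEnd.comp_app, Functor.Monoidal.μ_δ]; rfl
  unfold composeInclusion composeProjection
  have h2 : (M.obj X).obj.map u' ≫ (M.obj X).obj.map v' = 𝟙 _ := by
    rw [← Functor.map_comp, h', CategoryTheory.Functor.map_id]
  calc _ = u ≫ (M.obj X).obj.map u' ≫ ((Functor.LaxMonoidal.μ M X Y).hom.app (S k) ≫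
      (Functor.OplaxMonoidal.δ M X Y).hom.app (S k)) ≫ (M.obj X).obj.map v' ≫ v := by
        simp only [Category.assoc]
    _ = u ≫ (M.obj X).obj.map u' ≫ (M.obj X).obj.map v' ≫ v := by
        rw [h1]; exact congrArg (fun x => u ≫ (M.obj X).obj.map u' ≫ x) (Category.id_comp _)
    _ = _ := by rw [reassoc_of% h2, h]

omit [RightRigidCategory C] in
theorem matrixHom_compose :
    matrixHom hS (M.obj (X ⊗ Y)) (M.obj (X ⊗ Y))
        (composeProjection v v' ≫ composeInclusion u u') =
      Functor.OplaxMonoidal.δ M X Y ≫ (matrixHom hS (M.obj X) (M.obj X) (v ≫ u) ⊗ₘ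
        matrixHom hS (M.obj Y) (M.obj Y) (v' ≫ u')) ≫ Functor.LaxMonoidal.μ M X Y := by
  symm
  refine eq_matrixHom hS ?_ fun l hl => ?_
  -- Naturality along v' moves the first factor from M(Y)(S k) to `S j`, where its component is v ≫
  -- u.
  · rw [LinEnd.comp_app, LinEnd.comp_app, LinEnd.tensorHom_app, matrixHom_app,
      CategoryTheory.Functor.map_comp, ← Category.assoc (((matrixHom hS _ _ _).hom.app _)),
      ← LinEnd.naturality, matrixHom_app]
    simp only [composeProjection, composeInclusion, Category.assoc]
  · rw [LinEnd.comp_app, LinEnd.comp_app, LinEnd.tensorHom_app, matrixHom_app_of_ne hS _ _ hl,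
      LinEnd.map_zero, comp_zero, zero_comp, comp_zero]

omit [MonoidalCategory C] [RightRigidCategory C] [M.Monoidal] in
theorem innerAction_simpleProjection_comp_matrixHom :
    innerAction (M.obj X) (simpleProjection hS j) ≫ matrixHom hS (M.obj X) (M.obj X) (v ≫ u) =
      matrixHom hS (M.obj X) (M.obj X) (v ≫ u) := by
  refine eq_matrixHom hS ?_ fun l hl => ?_
  · rw [LinEnd.comp_app, innerAction_app, natApp_simpleProjection, if_pos rfl,
      CategoryTheory.Functor.map_id, Category.id_comp, matrixHom_app]
  · rw [LinEnd.comp_app, matrixHom_app_of_ne hS _ _ hl, comp_zero]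

end Composition

omit [RightRigidCategory C] [IsFiniteSemisimple K B] [IsAlgClosed K] [DecidableEq ι] in
theorem IsLinked.trans {i j k : ι} : IsLinked M S i j → IsLinked M S j k → IsLinked M S i k
  | ⟨X, u, v, h⟩, ⟨Y, u', v', h'⟩ => ⟨X ⊗ Y, composeInclusion u u', composeProjection v v',
      composeInclusion_comp_composeProjection u v u' v' h h'⟩

/-- The trace of e_ij ⊗ e_jk is a nested loop. The inner loop contributes d_jk φ^j, and φ^j inside a
loop carrying e_ij has no effect, so the outer loop contributes d_ij. -/
theorem matrixUnitDim_mul {i j k : ι} (hij : IsLinked M S i j) (hjk : IsLinked M S j k) :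
    matrixUnitDim hS hM i k = matrixUnitDim hS hM i j * matrixUnitDim hS hM j k := by
  obtain ⟨X, u, v, h⟩ := hij
  obtain ⟨Y, u', v', h'⟩ := hjk
  refine matrixUnitDim_eq hS hM (composeInclusion_comp_composeProjection u v u' v' h h') ?_
  rw [matrixHom_compose, loopTrace_tensor, loopTrace_matrixHom hS hM h', encircle_smul_right,
    encircle_eq_innerAction, ← Category.assoc, innerAction_simpleProjection_comp_matrixHom]
  rw [mul_comm, mul_smul]
  exact congrArg (_ • ·) (loopTrace_matrixHom hS hM h)

-- M(X^∨) is left adjoint to M(X). The adjunct w : M(X^∨)(S i) ⟶ S j of the nonzero map u is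
-- nonzero, hence a split epimorphism by semisimplicity.
omit [IsAlgClosed K] [DecidableEq ι] in
include hS in
theorem IsLinked.symm {i j : ι} : IsLinked M S i j → IsLinked M S j i := by
  rintro ⟨X, u, v, h⟩
  let w : (M.obj (dual X)).obj.obj (S i) ⟶ S j :=
    (M.obj (dual X)).obj.map u ≫ (ε_ (M.obj X) (M.obj (dual X))).hom.app (S j)
  have hw : w ≠ 0 := by
    intro hw
    -- The zigzag identity recovers u from w, so w = 0 would force u = 0 and then 𝟙 (S i) = 0.
    have h1 : (η_ (M.obj X) (M.obj (dual X))).hom.app (S i) ≫ (M.obj X).obj.map w = u := by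
      have h2 := congrArg (fun f => f.hom.app (S j))
        (ExactPairing.evaluation_coevaluation (M.obj X) (M.obj (dual X)))
      have h3 : (η_ (M.obj X) (M.obj (dual X))).hom.app ((M.obj X).obj.obj (S j)) ≫
          (M.obj X).obj.map ((ε_ (M.obj X) (M.obj (dual X))).hom.app (S j)) = 𝟙 _ := by
        have h4 : (η_ (M.obj X) (M.obj (dual X)) ▷ M.obj X ≫
          (α_ (M.obj X) (M.obj (dual X)) (M.obj X)).hom ≫
            M.obj X ◁ ε_ (M.obj X) (M.obj (dual X))).hom.app (S j) =
          (η_ (M.obj X) (M.obj (dual X))).hom.app ((M.obj X).obj.obj (S j)) ≫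
          (M.obj X).obj.map ((ε_ (M.obj X) (M.obj (dual X))).hom.app (S j)) :=
          congrArg (_ ≫ ·) (Category.id_comp _)
        exact h4.symm.trans (h2.trans (Category.comp_id _))
      have h5 := LinEnd.naturality (η_ (M.obj X) (M.obj (dual X))) u
      have h6 : (M.obj X).obj.map w =
          (M.obj X ⊗ M.obj (dual X)).obj.map u ≫
            (M.obj X).obj.map ((ε_ (M.obj X) (M.obj (dual X))).hom.app (S j)) :=
        (M.obj X).obj.map_comp _ _
      rw [h6, ← Category.assoc, ← h5, Category.assoc]
      exact (congrArg (u ≫ ·) h3).trans (Category.comp_id u)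
    rw [hw, LinEnd.map_zero, comp_zero] at h1
    rw [← h1, zero_comp] at h
    have := hS.simple i
    exact id_nonzero _ h.symm
  obtain ⟨g, hg⟩ := hS.exists_section K hw
  exact ⟨dual X, g, w, hg⟩

/-- The inverse is d_ji, because d_ij d_ji = d_ii = 1. -/
theorem matrixUnitDim_ne_zero {i j : ι} (h : IsLinked M S i j) : matrixUnitDim hS hM i j ≠ 0 := by
  intro h0
  have h1 := matrixUnitDim_mul hS hM h (h.symm hS)
  rw [matrixUnitDim_self, h0, zero_mul] at h1
  exact one_ne_zero h1

/-- The dimensions of the matrix units form a coboundary. -/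
theorem exists_matrixUnitDim_eq_div :
    ∃ lam : ι → Kˣ, ∀ i j, IsLinked M S i j →
      matrixUnitDim hS hM i j = (lam j : K) / (lam i : K) := by
  let R : Setoid ι := ⟨IsLinked M S, isLinked_refl M S, fun h => h.symm hS, fun h h' => h.trans h'⟩
  -- A base point r is fixed in each linkage class and λ_i is taken to be d_{r,i}; then λ_j = λ_i
  -- d_ij is multiplicativity along r, i, j.
  let r : ι → ι := fun i => (Quotient.mk R i).out
  have hr : ∀ i, IsLinked M S (r i) i := fun i => Quotient.exact (Quotient.out_eq (Quotient.mk R i))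
  refine ⟨fun i => Units.mk0 (matrixUnitDim hS hM (r i) i) (matrixUnitDim_ne_zero hS hM (hr i)),
    fun i j h => ?_⟩
  have hij : r i = r j := congrArg Quotient.out (Quotient.sound (s := R) h)
  rw [Units.val_mk0, Units.val_mk0, eq_div_iff (matrixUnitDim_ne_zero hS hM (hr i)), ← hij,
    matrixUnitDim_mul hS hM (hr i) h, mul_comm]

end Loops

/-! ### Duals of retracts. -/

section RetractDual

variable {A : Type u₁} [Category.{v₁} A] [MonoidalCategory A]

theorem mate_comp {V V' W W' U U' : A} [ExactPairing V V'] [ExactPairing W W'] [ExactPairing U U']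
    (f : V ⟶ W) (g : W ⟶ U) :
    (mate (f ≫ g) : U' ⟶ V') = (mate g : U' ⟶ W') ≫ (mate f : W' ⟶ V') := by
  symm
  apply eq_mate
  rw [MonoidalCategory.whiskerLeft_comp, reassoc_of% coevaluation_mate (V' := W') (W' := U') g,
    ← whisker_exchange, reassoc_of% coevaluation_mate (V' := V') (W' := W') f, comp_whiskerRight]

variable {V V' R R' : A} [ExactPairing V V'] (r : Retract R V) (r' : Retract R' V')

/-- A retract of an object with a dual has a dual, the retract of the dual cut out by the dual
idempotent. -/
@[reducible]
def Retract.exactPairing (h : r'.r ≫ r'.i = mate (r.r ≫ r.i)) : ExactPairing R R' where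
  coevaluation' := η_ V V' ≫ V ◁ r'.r ≫ r.r ▷ R'
  evaluation' := r'.i ▷ R ≫ V' ◁ r.i ≫ ε_ V V'
  coevaluation_evaluation' := by
    -- The idempotent of V slides across the coevaluation to its dual on V', where `r'.r` absorbs
    -- it; the zigzag for V then applies.
    have h1 : (η_ V V' ≫ V ◁ r'.r ≫ r.r ▷ R') ≫ r.i ▷ R' = η_ V V' ≫ V ◁ r'.r := by
      have h2 := coevaluation_mate (V' := V') (W' := V') (r.r ≫ r.i)
      calc _ = η_ V V' ≫ V ◁ r'.r ≫ (r.r ≫ r.i) ▷ R' := by simp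
        _ = η_ V V' ≫ (r.r ≫ r.i) ▷ V' ≫ V ◁ r'.r := by rw [whisker_exchange]
        _ = η_ V V' ≫ V ◁ (r'.r ≫ r'.i ≫ r'.r) := by
          rw [← reassoc_of% h2, ← h]; simp only [MonoidalCategory.whiskerLeft_comp, Category.assoc]
        _ = _ := by simp
    have h3 := ExactPairing.coevaluation_evaluation V V'
    calc _ = R' ◁ (η_ V V' ≫ V ◁ r'.r ≫ r.r ▷ R') ≫ r'.i ▷ (R ⊗ R') ≫ (α_ _ _ _).inv ≫
          (V' ◁ r.i) ▷ R' ≫ ε_ V V' ▷ R' := by simp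
      _ = r'.i ▷ 𝟙_ A ≫ V' ◁ ((η_ V V' ≫ V ◁ r'.r ≫ r.r ▷ R') ≫ r.i ▷ R') ≫
          (α_ _ _ _).inv ≫ ε_ V V' ▷ R' := by
        rw [whisker_exchange_assoc]; simp
      _ = r'.i ▷ 𝟙_ A ≫ V' ◁ η_ V V' ≫ (α_ _ _ _).inv ≫ (V' ⊗ V) ◁ r'.r ≫ ε_ V V' ▷ R' := by
        rw [h1]; simp
      _ = r'.i ▷ 𝟙_ A ≫ (V' ◁ η_ V V' ≫ (α_ _ _ _).inv ≫ ε_ V V' ▷ V') ≫ 𝟙_ A ◁ r'.r := by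
        rw [whisker_exchange]; simp
      _ = _ := by rw [h3]; simp
  evaluation_coevaluation' := by
    -- Here the dual idempotent slides the other way and is absorbed by `r.r`.
    have h1 : (η_ V V' ≫ V ◁ r'.r ≫ r.r ▷ R') ≫ R ◁ r'.i = η_ V V' ≫ r.r ▷ V' := by
      have h2 := coevaluation_mate (V' := V') (W' := V') (r.r ≫ r.i)
      calc _ = η_ V V' ≫ V ◁ (r'.r ≫ r'.i) ≫ r.r ▷ V' := by
            simp only [Category.assoc, ← whisker_exchange]; simp
        _ = η_ V V' ≫ (r.r ≫ r.i ≫ r.r) ▷ V' := by rw [h, reassoc_of% h2]; simp only [comp_whiskerRight, Category.assoc]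
        _ = _ :=by
          have h4 : r.r ≫ r.i ≫ r.r = r.r := by rw [r.retract, Category.comp_id]
          rw [h4]
    have h3 := ExactPairing.evaluation_coevaluation V V'
    calc _ = (η_ V V' ≫ V ◁ r'.r ≫ r.r ▷ R') ▷ R ≫ (R ◁ r'.i) ▷ R ≫ (α_ _ _ _).hom ≫
          R ◁ V' ◁ r.i ≫ R ◁ ε_ V V' := by simp
      _ = ((η_ V V' ≫ V ◁ r'.r ≫ r.r ▷ R') ≫ R ◁ r'.i) ▷ R ≫ (α_ _ _ _).hom ≫
          R ◁ V' ◁ r.i ≫ R ◁ ε_ V V' := by simp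
      _ = (η_ V V' ▷ R ≫ (V ⊗ V') ◁ r.i) ≫ (α_ _ _ _).hom ≫ r.r ▷ (V' ⊗ V) ≫ R ◁ ε_ V V' := by
        rw [h1]
        simp only [comp_whiskerRight, Category.assoc, associator_naturality_left_assoc,
          tensor_whiskerLeft, Iso.inv_hom_id_assoc]
        rw [whisker_exchange_assoc]
      _ = 𝟙_ A ◁ r.i ≫ (η_ V V' ▷ V ≫ (α_ _ _ _).hom ≫ V ◁ ε_ V V') ≫ r.r ▷ 𝟙_ A := by
        rw [← whisker_exchange r.r, ← whisker_exchange]; simp only [Category.assoc]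
      _ = _ := by rw [h3]; simp

end RetractDual

/-! ### Idempotents in End(B) and the existence of duals for summands. -/

section SplitIdempotents

variable {K : Type w} [Field K] {B : Type u₁} [Category.{v₁} B] [Abelian B] [Linear K B]

/-- Idempotents of `End(B)` split. -/
theorem LinEnd.exists_retract {V : LinEnd K B} (e : V ⟶ V) (he : e ≫ e = e) :
    ∃ (A : LinEnd K B) (r : Retract A V), r.r ≫ r.i = e := by
  obtain ⟨F, i, p, hip, hpi⟩ := IsIdempotentComplete.idempotents_split V.obj e.hom
    (congrArg (fun f => f.hom) he)
  have := V.property.1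
  have := V.property.2
  -- The splitting is found among all endofunctors; this formula passes additivity and linearity
  -- from V to F.
  have hF : ∀ {a b : B} (f : a ⟶ b), F.map f = i.app a ≫ V.obj.map f ≫ p.app b := by
    intro a b f
    have h : i.app b ≫ p.app b = 𝟙 _ := NatTrans.congr_app hip b
    rw [← Category.assoc, ← i.naturality, Category.assoc, h, Category.comp_id]
  have h1 : F.Additive := ⟨fun {a b f g} => by
    rw [hF, hF, hF, V.obj.map_add, Preadditive.add_comp, Preadditive.comp_add]⟩
  have h2 : F.Linear K := ⟨fun {a b} f c => by
    rw [hF, hF, V.obj.map_smul, Linear.smul_comp, Linear.comp_smul]⟩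
  refine ⟨⟨F, h1, h2⟩, ⟨ObjectProperty.homMk i, ObjectProperty.homMk p, ?_⟩, ?_⟩
  · ext b; exact NatTrans.congr_app hip b
  · ext b; exact NatTrans.congr_app hpi b

/-- A retract of an object of `End(B)` with a double dual has a double dual. -/
theorem LinEnd.exists_exactPairing {V V' V'' A : LinEnd K B} [ExactPairing V V']
    [ExactPairing V' V''] (r : Retract A V) :
    ∃ A' A'' : LinEnd K B, Nonempty (ExactPairing A A') ∧ Nonempty (ExactPairing A' A'') := by
  have h : (r.r ≫ r.i) ≫ r.r ≫ r.i = r.r ≫ r.i := by simp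
  have h' : (mate (r.r ≫ r.i) : V' ⟶ V') ≫ (mate (r.r ≫ r.i) : V' ⟶ V') =
    mate (r.r ≫ r.i) := by rw [← mate_comp, h]
  obtain ⟨A', r', hr'⟩ := LinEnd.exists_retract (mate (r.r ≫ r.i) : V' ⟶ V') h'
  have h'' : (mate (r'.r ≫ r'.i) : V'' ⟶ V'') ≫ (mate (r'.r ≫ r'.i) : V'' ⟶ V'') =
    mate (r'.r ≫ r'.i) := by rw [← mate_comp]; simp
  obtain ⟨A'', r'', hr''⟩ := LinEnd.exists_retract (mate (r'.r ≫ r'.i) : V'' ⟶ V'') h''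
  exact ⟨A', A'', ⟨Retract.exactPairing r r' hr'⟩, ⟨Retract.exactPairing r' r'' hr''⟩⟩

end SplitIdempotents

/-! ### Comparison of the induced and the standard pivotal structure. -/

section Compare

variable {K : Type w} [Field K]
  {C : Type u₁} [Category.{v₁} C] [MonoidalCategory C] [RightRigidCategory C]
  {B : Type u₂} [Category.{v₂} B] [Abelian B] [Linear K B]
  {P : PivotalStructure C} {M : C ⥤ LinEnd K B} [M.Monoidal]

/-- The double dual of `r.r` in `inducedPivotal` is precisely what appears when `r.r` is moved round
the loop. So dimensions taken with arbitrary duals of A become traces on M(X). -/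
theorem encircle_inducedPivotal {A : LinEnd K B} {X : C} (r : Retract A (M.obj X))
    (A' A'' : LinEnd K B) [ExactPairing A A'] [ExactPairing A' A''] :
    encircle A' A'' (inducedPivotal P M r A' A'') (𝟙 _) = loopTrace P M (r.r ≫ r.i) := by
  unfold loopTrace inducedPivotal
  rw [Category.assoc r.r, encircle_cyclic (V := M.obj X) (W := A) (W' := A') (W'' := A'') r.r,
    Category.assoc]

variable [IsFiniteSemisimple K B] {ι : Type*} {S : ι → B} (hS : IsCompleteSetOfSimples S)
include hS

omit [RightRigidCategory C] [M.Monoidal] [IsFiniteSemisimple K B] [MonoidalCategory C] hS in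
theorem IsMatrixUnit.exists_entry {i j : ι} {A : LinEnd K B} (hA : IsMatrixUnit S i j A) {X : C}
    (r : Retract A (M.obj X)) : ∃ (u : S i ⟶ (M.obj X).obj.obj (S j))
      (v : (M.obj X).obj.obj (S j) ⟶ S i), u ≫ v = 𝟙 _ ∧ (r.r ≫ r.i).hom.app (S j) = v ≫ u := by
  obtain ⟨⟨e⟩, -⟩ := hA
  have h : r.i.hom.app (S j) ≫ r.r.hom.app (S j) = 𝟙 _ := by
    rw [← LinEnd.comp_app, r.retract]; rfl
  refine ⟨e.inv ≫ r.i.hom.app (S j), r.r.hom.app (S j) ≫ e.hom, ?_, ?_⟩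
  · rw [Category.assoc, reassoc_of% h, e.inv_hom_id]
  · rw [Category.assoc, e.hom_inv_id_assoc, LinEnd.comp_app]

omit hS [IsFiniteSemisimple K B] in
theorem IsMatrixUnit.app_eq_zero {i j k : ι} {A W U : LinEnd K B} (hA : IsMatrixUnit S i j A)
    (h : k ≠ j) (f : U ⟶ A) (g : A ⟶ W) : (f ≫ g).hom.app (S k) = 0 := by
  rw [LinEnd.comp_app, (hA.2 k h).eq_of_tgt (f.hom.app (S k)) 0, zero_comp]

variable [IsAlgClosed K]

theorem IsMatrixUnit.exists_smul_id {i j : ι} {A : LinEnd K B} (hA : IsMatrixUnit S i j A)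
    (f : A ⟶ A) : ∃ c : K, f = c • 𝟙 A := by
  obtain ⟨e⟩ := hA.1
  obtain ⟨c, hc⟩ := hS.exists_smul_id (K := K) (e.inv ≫ f.hom.app (S j) ≫ e.hom)
  refine ⟨c, LinEnd.hom_ext_simples hS fun k => ?_⟩
  by_cases hk : k = j
  · subst hk
    rw [LinEnd.smul_app, LinEnd.id_app, ← cancel_epi e.inv, ← cancel_mono e.hom, Category.assoc,
      hc]
    simp
  · exact (hA.2 k hk).eq_of_src _ _

theorem finrank_hom_simples [DecidableEq ι] (i k : ι) :
    Module.finrank K (S k ⟶ S i) = if i = k then 1 else 0 := by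
  have := hS.simple i
  have := hS.simple k
  split_ifs with h
  · subst h
    have := IsFiniteSemisimple.finite_hom (K := K) (S i) (S i)
    exact finrank_endomorphism_simple_eq_one K (S i)
  · exact finrank_hom_simple_simple_eq_zero_of_not_iso K fun e => h (hS.eq_of_iso k i ⟨e⟩).symm

/-- The standard trace of a scalar endomorphism of a matrix unit. -/
theorem IsMatrixUnit.sum_trace [Fintype ι] [DecidableEq ι] {i j : ι} {A : LinEnd K B}
    (hA : IsMatrixUnit S i j A) (c : K) (k : ι) :
    (∑ l, LinearMap.trace K (S k ⟶ A.obj.obj (S l))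
      (Linear.rightComp K (S k) ((c • 𝟙 A : A ⟶ A).hom.app (S l)))) = if i = k then c else 0 := by
  obtain ⟨e⟩ := hA.1
  rw [Finset.sum_eq_single j]
  · have h : Linear.rightComp K (S k) ((c • 𝟙 A : A ⟶ A).hom.app (S j)) =
        c • LinearMap.id := by
      ext f
      rw [LinEnd.smul_app, LinEnd.id_app]
      simp
    have h2 : Module.finrank K (S k ⟶ A.obj.obj (S j)) = Module.finrank K (S k ⟶ S i) :=
      LinearEquiv.finrank_eq (Linear.homCongr K (Iso.refl (S k)) e)
    have := IsFiniteSemisimple.finite_hom (K := K) (S k) (A.obj.obj (S j))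
    rw [h, LinearMap.map_smul, LinearMap.trace_id, h2, finrank_hom_simples hS]
    split_ifs <;> simp
  · intro l _ hl
    have h : Linear.rightComp K (S k) ((c • 𝟙 A : A ⟶ A).hom.app (S l)) = 0 := by
      ext f
      exact (hA.2 l hl).eq_of_tgt _ _
    rw [h, map_zero]
  · simp

theorem encircle_inducedPivotal_matrixUnit [DecidableEq ι] (hM : IsPivotalModuleCategory P M)
    {i j : ι} {A : LinEnd K B} (hA : IsMatrixUnit S i j A) {X : C} (r : Retract A (M.obj X))
    (A' A'' : LinEnd K B) [ExactPairing A A'] [ExactPairing A' A''] :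
    encircle A' A'' (inducedPivotal P M r A' A'') (𝟙 _) =
      matrixUnitDim hS hM i j • simpleProjection hS i := by
  obtain ⟨u, v, huv, hr⟩ := hA.exists_entry r
  rw [encircle_inducedPivotal, eq_matrixHom hS hr fun k hk => hA.app_eq_zero hk _ _,
    loopTrace_matrixHom hS hM huv]

/-- All endomorphisms of e_ij are scalars, so the trace condition reduces to a single number: the
rescaled structure must give e_ij dimension 1. -/
theorem isStandardPivotal_smul_inducedPivotal_iff [Fintype ι] [DecidableEq ι]
    (hM : IsPivotalModuleCategory P M)
    {i j : ι} {A : LinEnd K B} (hA : IsMatrixUnit S i j A) {X : C} (r : Retract A (M.obj X))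
    (A' A'' : LinEnd K B) [ExactPairing A A'] [ExactPairing A' A''] (c : K) :
    IsStandardPivotal S A' A'' (c • inducedPivotal P M r A' A'') ↔
      c * matrixUnitDim hS hM i j = 1 := by
  have key : ∀ (d : K) (k : ι), natApp (η_ A A' ≫
      ((d • 𝟙 A) ≫ (c • inducedPivotal P M r A' A'')) ▷ A' ≫ ε_ A' A'') (S k) =
        (d * (c * matrixUnitDim hS hM i j)) • if i = k then 𝟙 (S k) else 0 := by
    intro d k
    rw [← encircle_id_right, Linear.smul_comp, Category.id_comp, encircle_smul_left,
      encircle_smul_left, encircle_inducedPivotal_matrixUnit hS hM hA, smul_smul, smul_smul,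
      ← natApp_simpleProjection (K := K) hS i k, mul_assoc]
    rfl
  constructor
  · intro h
    -- The identity of A, tested at `S i`, already forces the equation.
    have h1 := h ((1 : K) • 𝟙 A) i
    rw [key, hA.sum_trace hS, if_pos rfl, if_pos rfl, one_mul] at h1
    exact hS.smul_id_injective h1
  · intro h f k
    obtain ⟨d, rfl⟩ := hA.exists_smul_id hS f
    rw [key, hA.sum_trace hS, h, mul_one]
    split_ifs <;> simp

omit hS [IsFiniteSemisimple K B] [IsAlgClosed K] [RightRigidCategory C] [M.Monoidal]
  [MonoidalCategory C] in
theorem IsMatrixUnit.isLinked {i j : ι} {A : LinEnd K B} (hA : IsMatrixUnit S i j A) {X : C}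
    (r : Retract A (M.obj X)) : IsLinked M S i j :=
  let ⟨u, v, huv, _⟩ := hA.exists_entry r
  ⟨X, u, v, huv⟩

-- The image of the idempotent v ≫ u, extended by zero to the other simple objects, is e_ij.
omit [MonoidalCategory C] [RightRigidCategory C] [M.Monoidal] in
theorem IsLinked.exists_matrixUnit [DecidableEq ι] {i j : ι} (h : IsLinked M S i j) :
    ∃ (A : LinEnd K B) (X : C), IsMatrixUnit S i j A ∧ Nonempty (Retract A (M.obj X)) := by
  obtain ⟨X, u, v, huv⟩ := h
  have he : matrixHom hS (M.obj X) (M.obj X) (v ≫ u) ≫ matrixHom hS (M.obj X) (M.obj X) (v ≫ u) =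
      matrixHom hS (M.obj X) (M.obj X) (v ≫ u) := by
    rw [matrixHom_comp, Category.assoc, reassoc_of% huv]
  obtain ⟨A, r, hr⟩ := LinEnd.exists_retract _ he
  have h1 : ∀ k, r.i.hom.app (S k) ≫ r.r.hom.app (S k) = 𝟙 _ := fun k => by
    rw [← LinEnd.comp_app, r.retract]; rfl
  have h2 : r.r.hom.app (S j) ≫ r.i.hom.app (S j) = v ≫ u := by
    rw [← LinEnd.comp_app, hr, matrixHom_app]
  refine ⟨A, X, ⟨⟨⟨r.i.hom.app (S j) ≫ v, u ≫ r.r.hom.app (S j), ?_, ?_⟩⟩, fun k hk => ?_⟩, ⟨r⟩⟩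
  · rw [Category.assoc, ← Category.assoc v u, ← h2, Category.assoc, reassoc_of% h1, h1]
  · rw [Category.assoc, ← Category.assoc (r.r.hom.app _), h2, Category.assoc, huv,
      Category.comp_id, huv]
  · have h3 : r.r.hom.app (S k) ≫ r.i.hom.app (S k) = 0 := by
      rw [← LinEnd.comp_app, hr, matrixHom_app_of_ne hS _ _ hk]
    rw [IsZero.iff_id_eq_zero]
    calc _ = (r.i.hom.app (S k) ≫ r.r.hom.app (S k)) ≫ r.i.hom.app (S k) ≫ r.r.hom.app (S k) := by
          rw [h1, Category.comp_id]
      _ = 0 := by rw [Category.assoc, reassoc_of% h3, zero_comp, comp_zero]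

/-- With c = λ_i / λ_j the equation c d_ij = 1 reads d_ij = λ_j / λ_i. The forward direction needs
an actual matrix unit with a double dual for each linked pair; splitting idempotents provides both.
-/
theorem comparesPivotal_iff [Fintype ι] [DecidableEq ι] (hM : IsPivotalModuleCategory P M)
    (lam : ι → Kˣ) : ComparesPivotal P M S lam ↔
      ∀ i j, IsLinked M S i j → matrixUnitDim hS hM i j = (lam j : K) / (lam i : K) := by
  have key : ∀ (i j : ι) (d : K), (lam i : K) / (lam j : K) * d = 1 ↔
      d = (lam j : K) / (lam i : K) := fun i j d => by
    rw [mul_comm, mul_eq_one_iff_eq_inv₀ (div_ne_zero (lam i).ne_zero (lam j).ne_zero), inv_div]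
  constructor
  · intro h i j hij
    obtain ⟨A, X, hA, ⟨r⟩⟩ := hij.exists_matrixUnit hS
    obtain ⟨A', A'', ⟨_⟩, ⟨_⟩⟩ := LinEnd.exists_exactPairing (V' := M.obj (dual X))
      (V'' := M.obj (ddual X)) r
    obtain ⟨q, hq, rfl⟩ := h i j A hA X r A' A''
    exact (key i j _).1 ((isStandardPivotal_smul_inducedPivotal_iff hS hM hA r A' A'' _).1 hq)
  · intro h i j A hA X r A' A'' _ _
    exact ⟨_, (isStandardPivotal_smul_inducedPivotal_iff hS hM hA r A' A'' _).2
      ((key i j _).2 (h i j (hA.isLinked r))), rfl⟩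

end Compare

/-! ### Classes of simple objects as a basis of Gr(B). -/

section GrothendieckBasis

variable {B : Type u₁} [Category.{v₁} B] [Abelian B]

/-- The dimension of `Hom(X, -)` as a function on the Grothendieck group. -/
noncomputable def Gr.finrankHom (K : Type w) [Field K] [Linear K B] [IsFiniteSemisimple K B]
    (X : B) : Gr B →+ ℤ :=
  Gr.lift (fun b => (Module.finrank K (X ⟶ b) : ℤ)) fun Y Z W e => by
    let f : (X ⟶ W) ≃ₗ[K] (X ⟶ Y) × (X ⟶ Z) :=
      { toFun := fun g => (g ≫ e.hom ≫ biprod.fst, g ≫ e.hom ≫ biprod.snd)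
        invFun := fun g => biprod.lift g.1 g.2 ≫ e.inv
        map_add' := fun g h => by simp
        map_smul' := fun c g => by simp
        left_inv := fun g => by
          rw [← cancel_mono e.hom]
          ext <;> simp
        right_inv := fun g => by ext <;> simp }
    have := IsFiniteSemisimple.finite_hom (K := K) X Y
    have := IsFiniteSemisimple.finite_hom (K := K) X Z
    rw [f.finrank_eq, Module.finrank_prod, Nat.cast_add]

variable (K : Type w) [Field K] [IsAlgClosed K] [Linear K B] [IsFiniteSemisimple K B]
  {ι : Type*} [Fintype ι] [DecidableEq ι] {S : ι → B} (hS : IsCompleteSetOfSimples S)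

/-- The classes of the simple objects form a basis of the Grothendieck group. -/
noncomputable def grBasis : Module.Basis ι ℤ (Gr B) :=
  Module.Basis.mk (v := fun i => Gr.mk (S i))
    (Fintype.linearIndependent_iff.2 fun c hc j => by
      have h := congrArg (Gr.finrankHom K (S j)) hc
      -- By Schur's lemma, dim Hom(S j, -) is the coordinate functional of `S j`.
      have h1 : ∀ i, Gr.finrankHom K (S j) (Gr.mk (S i)) = if i = j then 1 else 0 := fun i => by
        rw [Gr.finrankHom, Gr.lift_mk, finrank_hom_simples hS]
        split_ifs <;> rfl
      simpa [h1] using h)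
    (fun x _ => by
      induction x using Gr.induction with
      | zero => exact Submodule.zero_mem _
      | add x y hx hy => exact Submodule.add_mem _ (hx trivial) (hy trivial)
      | neg x hx => exact Submodule.neg_mem _ (hx trivial)
      | mk b =>
        obtain ⟨n, s, p, m, -, -, hb⟩ := hS.exists_decomposition K b
        rw [hb]
        exact Submodule.sum_mem _ fun k _ => Submodule.subset_span ⟨s k, rfl⟩)

theorem grBasis_apply (i : ι) : grBasis K hS i = Gr.mk (S i) :=
  Module.Basis.mk_apply _ _ i

end GrothendieckBasis

/-! ### The corresponding basis of the NIM-rep. -/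

section NIMRep

variable {K : Type w} [Field K] [IsAlgClosed K]
  {C : Type u₁} [Category.{v₁} C]
  {B : Type u₂} [Category.{v₂} B] [Abelian B] [Linear K B] [IsFiniteSemisimple K B]
  {ι : Type*} [Fintype ι] [DecidableEq ι] {S : ι → B} (hS : IsCompleteSetOfSimples S)

/-- The basis of the complexified NIM-rep given by the classes of the simple objects. -/
noncomputable def nimBasis (M : C ⥤ LinEnd K B) : Module.Basis ι K (NIMRep M) :=
  Algebra.TensorProduct.basis K (grBasis K hS)

theorem nimBasis_apply (M : C ⥤ LinEnd K B) (i : ι) : nimBasis hS M i = NIMRep.mk M (S i) :=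
  (Algebra.TensorProduct.basis_apply (grBasis K hS) i).trans
    (congrArg ((1 : K) ⊗ₜ[ℤ] ·) (grBasis_apply K hS i))

omit [IsAlgClosed K] [IsFiniteSemisimple K B] [Fintype ι] [DecidableEq ι] in
theorem NIMRep.mk_eq_sum (M : C ⥤ LinEnd K B) {b : B} {n : ℕ} {s : Fin n → ι}
    (h : Gr.mk b = ∑ k, Gr.mk (S (s k))) : NIMRep.mk M b = ∑ k, NIMRep.mk M (S (s k)) :=
  (congrArg ((1 : K) ⊗ₜ[ℤ] ·) h).trans (TensorProduct.tmul_sum _ _ _)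

end NIMRep

/-! ### The intertwiner between the encircling module and the NIM-rep. -/

section Intertwiner

variable {K : Type w} [Field K] [IsAlgClosed K]
  {C : Type u₁} [Category.{v₁} C] [MonoidalCategory C] [RightRigidCategory C]
  {B : Type u₂} [Category.{v₂} B] [Abelian B] [Linear K B] [IsFiniteSemisimple K B]
  {ι : Type*} [DecidableEq ι] {S : ι → B} (hS : IsCompleteSetOfSimples S)
  {P : PivotalStructure C} {M : C ⥤ LinEnd K B} [M.Monoidal]

/-- Encircling the projection to `S j` with `M(X)`, in terms of a decomposition of `M(X)(S j)`. -/
theorem encircleBy_simpleProjection (hM : IsPivotalModuleCategory P M) (X : C) (j : ι)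
    {n : ℕ} {s : Fin n → ι} {p : ∀ k, (M.obj X).obj.obj (S j) ⟶ S (s k)}
    {m : ∀ k, S (s k) ⟶ (M.obj X).obj.obj (S j)} (hmp : ∀ k, m k ≫ p k = 𝟙 _)
    (hpm : ∑ k, p k ≫ m k = 𝟙 _) :
    encircleBy P M X (simpleProjection hS j) =
      ∑ k, matrixUnitDim hS hM (s k) j • simpleProjection hS (s k) := by
  -- M(X)(φ^j) is the identity on column j and zero elsewhere; the decomposition of M(X)(S j) breaks
  -- it into matrix-unit idempotents.
  have h : innerAction (M.obj X) (simpleProjection hS j) =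
      ∑ k, matrixHom hS (M.obj X) (M.obj X) (p k ≫ m k) := by
    rw [← matrixHom_sum, hpm]
    refine eq_matrixHom hS ?_ fun l hl => ?_
    · rw [innerAction_app, natApp_simpleProjection, if_pos rfl, CategoryTheory.Functor.map_id]
    · rw [innerAction_app, natApp_simpleProjection, if_neg (Ne.symm hl), LinEnd.map_zero]
  change encircle (M.obj (dual X)) (M.obj (ddual X)) (M.map (P.iso X).hom) _ = _
  rw [encircle_eq_innerAction, h]
  change loopTrace P M _ = _
  rw [loopTrace_sum]
  exact Finset.sum_congr rfl fun k _ => loopTrace_matrixHom hS hM (hmp k)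

variable [Fintype ι] [Preadditive C] [HasZeroObject C] [HasBinaryBiproducts C]
  [MonoidalPreadditive C] [M.Additive]

-- Reconciles the K-action that the NIM-rep carries directly with the scalars inside the fusion
-- algebra.
omit [IsAlgClosed K] [IsFiniteSemisimple K B] in
theorem nimRep_tmul_smul (c d : K) (X : C) (y : NIMRep M) :
    (c ⊗ₜ[ℤ] Gr.mk X : FusionAlgebra K C) • (d • y) =
      (c * d) • ((1 ⊗ₜ[ℤ] Gr.mk X : FusionAlgebra K C) • y) := by
  let f := (Module.End.baseChangeHom ℤ K (Gr B)).toRingHom.comp (nimHom M)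
  have h : ∀ (c : K) (y : NIMRep M), (c ⊗ₜ[ℤ] Gr.mk X : FusionAlgebra K C) • y =
    c • (show NIMRep M from f (Gr.mk X) (show K ⊗[ℤ] Gr B from y)) :=
    fun c y => extendScalars_tmul f c (Gr.mk X) y
  rw [h, h, one_smul, mul_smul]
  exact congrArg (c • ·) ((f (Gr.mk X)).map_smul d y)

omit [IsAlgClosed K] [DecidableEq ι] [IsFiniteSemisimple K B] in
/-- A `K`-linear map between the encircling module and the NIM-rep commutes with the fusion
algebra if it commutes with the classes of objects on a basis. -/
theorem map_fusionAlgebra_smul (b : Module.Basis ι K (EncirclingModule P M))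
    (f : EncirclingModule P M →ₗ[K] NIMRep M)
    (h : ∀ X i, f (encircleBy P M X (b i)) = (1 ⊗ₜ[ℤ] Gr.mk X : FusionAlgebra K C) • f (b i))
    (x : FusionAlgebra K C) (α : EncirclingModule P M) : f (x • α) = x • f α := by
  have hX : ∀ (c : K) (X : C) (α : EncirclingModule P M),
      f ((c ⊗ₜ[ℤ] Gr.mk X : FusionAlgebra K C) • α) =
        (c ⊗ₜ[ℤ] Gr.mk X : FusionAlgebra K C) • f α := by
    intro c X α
    have h1 : ((c ⊗ₜ[ℤ] Gr.mk X : FusionAlgebra K C) • α) =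
        c • (encircleBy P M X α : EncirclingModule P M) := encircling_smul P M c X α
    let E : EncirclingModule P M →ₗ[K] EncirclingModule P M := encircleBy P M X
    have h2 : ∀ α, f (E α) = (1 ⊗ₜ[ℤ] Gr.mk X : FusionAlgebra K C) • f α := by
      intro α
      rw [← b.sum_repr α]
      simp only [map_sum, map_smul, Finset.smul_sum]
      refine Finset.sum_congr rfl fun i _ => ?_
      rw [nimRep_tmul_smul, one_mul]
      exact congrArg (_ • ·) (h X i)
    refine (congrArg f h1).trans ((f.map_smul c (E α)).trans ?_)
    refine (congrArg (c • ·) (h2 α)).trans ?_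
    have h3 := nimRep_tmul_smul c 1 X (f α)
    rw [one_smul, mul_one] at h3
    exact h3.symm
  have h0 : f ((0 : FusionAlgebra K C) • α) = (0 : FusionAlgebra K C) • f α :=
    (congrArg f (zero_smul (FusionAlgebra K C) α)).trans
      ((map_zero f).trans (zero_smul (FusionAlgebra K C) (f α)).symm)
  induction x using TensorProduct.induction_on with
  | zero => exact h0
  | add x y hx hy => rw [add_smul, add_smul, map_add, hx, hy]
  | tmul c y =>
    induction y using Gr.induction with
    | zero => rw [TensorProduct.tmul_zero]; exact h0
    | add x y hx hy => rw [TensorProduct.tmul_add, add_smul, add_smul, map_add, hx, hy]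
    | neg x hx => rw [TensorProduct.tmul_neg, neg_smul, neg_smul, map_neg, hx]
    | mk X => exact hX c X α

/-- The isomorphism from the encircling module to the NIM-rep. -/
theorem exists_equiv_nimRep (hM : IsPivotalModuleCategory P M)
    (b : Module.Basis ι K (EncirclingModule P M)) (hb : ∀ i, b i = simpleProjection hS i)
    {lam : ι → Kˣ} (hlam : ComparesPivotal P M S lam) :
    ∃ Φ : EncirclingModule P M ≃ₗ[FusionAlgebra K C] NIMRep M,
      ∀ i, Φ (b i) = (lam i : K) • NIMRep.mk M (S i) := by
  -- The λ_i are units, so rescaling the classes [i] by them again gives a basis.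
  let e : EncirclingModule P M ≃ₗ[K] NIMRep M :=
    b.equiv ((nimBasis hS M).unitsSMul lam) (Equiv.refl ι)
  have he : ∀ i, e (b i) = (lam i : K) • NIMRep.mk M (S i) := fun i => by
    rw [Module.Basis.equiv_apply, Equiv.refl_apply, Module.Basis.unitsSMul_apply, nimBasis_apply]
    rfl
  refine ⟨{ e with map_smul' := map_fusionAlgebra_smul b e.toLinearMap fun X j => ?_ }, he⟩
  obtain ⟨n, s, p, m, hmp, hpm, hsum⟩ := hS.exists_decomposition K ((M.obj X).obj.obj (S j))
  have h1 : (encircleBy P M X (b j) : EncirclingModule P M) =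
      ∑ k, matrixUnitDim hS hM (s k) j • b (s k) := by
    rw [hb]
    refine (encircleBy_simpleProjection hS hM X j hmp hpm).trans ?_
    exact Finset.sum_congr rfl fun k _ => by rw [hb]; rfl
  have h2 : (1 ⊗ₜ[ℤ] Gr.mk X : FusionAlgebra K C) • ((lam j : K) • NIMRep.mk M (S j)) =
      (lam j : K) • ∑ k, NIMRep.mk M (S (s k)) := by
    rw [nimRep_tmul_smul, nimRep_smul, one_smul, one_mul, ← NIMRep.mk_eq_sum M hsum]
  change e _ = _ • e _
  rw [he, h2, h1, map_sum, Finset.smul_sum]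
  refine Finset.sum_congr rfl fun k _ => ?_
  -- The coefficient of [S (s k)] is d_{s k, j} λ_{s k}, which equals λ_j whatever k is.
  rw [map_smul, he, smul_smul,
    (comparesPivotal_iff hS hM lam).1 hlam (s k) j ⟨X, m k, p k, hmp k⟩,
    div_mul_cancel₀ _ (lam (s k)).ne_zero]

end Intertwiner

end FusionModules

/-! ### The main theorem. -/

open FusionModules
theorem mainTheorem2 {K : Type*} [Field K] [IsAlgClosed K] [CharZero K]
    -- a spherical fusion category
    {C : Type*} [Category* C] [Abelian C] [Linear K C] [MonoidalCategory C]
    [MonoidalPreadditive C] [MonoidalLinear K C] [RigidCategory C] [IsFusionCategory K C]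
    (P : PivotalStructure C) (hP : P.IsSpherical)
    -- a finite pivotal module category
    {B : Type*} [Category* B] [Abelian B] [Linear K B] [IsFiniteSemisimple K B]
    (M : C ⥤ LinEnd K B) [M.Additive] [M.Linear K] [M.Monoidal]
    (hM : IsPivotalModuleCategory P M)
    -- representatives of the simple objects
    {ι : Type*} [Fintype ι] [DecidableEq ι] (S : ι → B) (hS : IsCompleteSetOfSimples S) :
    ∃ φ : Module.Basis ι K (EncirclingModule P M),
      (∀ i j, natApp (φ i) (S j) = if i = j then 𝟙 (S j) else 0) ∧
      (∃ lam : ι → Kˣ, ComparesPivotal P M S lam) ∧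
      ∀ lam : ι → Kˣ, ComparesPivotal P M S lam →
        ∃ Φ : EncirclingModule P M ≃ₗ[FusionAlgebra K C] NIMRep M,
          ∀ i, Φ (φ i) = (lam i : K) • NIMRep.mk M (S i) := by
  let φ : Module.Basis ι K (EncirclingModule P M) := natBasis hS
  have hφ : ∀ i, φ i = simpleProjection hS i := natBasis_apply hS
  refine ⟨φ, fun i j => ?_, ?_, fun lam hlam => exists_equiv_nimRep hS hM φ hφ hlam⟩
  · rw [hφ]
    exact natApp_simpleProjection hS i j
  · obtain ⟨lam, hlam⟩ := exists_matrixUnitDim_eq_div hS hM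
    exact ⟨lam, (comparesPivotal_iff hS hM lam).2 hlam⟩
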